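/- Let $\mathbf X=(\mathbf X_I,\mathbf X_J)$ be a random vector in $\mathbb R^p\times\mathbb R^{d-p}$, where $I=\{1,\dots,p\}$, $J=\{p+1,\dots,d\}$, let $\mathbb P$ also denote its law, and let $\mathbf X_1,\mathbf X_2,\dots$ be i.i.d. copies of $\mathbf X$. Let $A_1,\dots,A_m$ be Borel subsets of $\mathbb R^{d-p}$ (not necessarily disjoint) with $p_k:=\mathbb P(\mathbf X_J\in A_k)>0$. Assume that for all $k\le m$ and $a\le p$ the conditional distribution function $t\mapsto\mathbb P(X_a\le t\mid \mathbf X_J\in A_k)$ is continuous. Let $\mathbb P_k$ be the law of $\mathbf X$ given $\mathbf X_J\in A_k$, let $p_{k,l}:=\mathbb P(\mathbf X_J\in A_k\cap A_l)$, and for $a<b\le p$ and $a'<b'\le p$ put $$\tau_{a,b,k}:=\mathbb P\big((X_{1,a}-X_{2,a})(X_{1,b}-X_{2,b})>0\mid \mathbf X_{1,J},\mathbf X_{2,J}\in A_k\big)-\mathbb P\big((X_{1,a}-X_{2,a})(X_{1,b}-X_{2,b})<0\mid \mathbf X_{1,J},\mathbf X_{2,J}\in A_k\big),$$ $$D_{a,b,k}:=\mathbb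 P\big(X_{1,a}<X_{2,a},\,X_{1,b}<X_{2,b},\,\mathbf X_{1,J}\in A_k,\,\mathbf X_{2,J}\in A_k\big),$$ $$\pi_{a,b}(\mathbf x_1,\mathbf x_2):=\tfrac12\big(\mathbf 1\{x_{1,a}<x_{2,a},x_{1,b}<x_{2,b}\}+\mathbf 1\{x_{2,a}<x_{1,a},x_{2,b}<x_{1,b}\}\big),$$ $$I_{a,b,a',b',k,l}:=\int \mathbf 1\{\mathbf x_{3,J}\in A_k\cap A_l\}\,\pi_{a,b}(\mathbf x_1,\mathbf x_3)\,\pi_{a',b'}(\mathbf x_2,\mathbf x_3)\,\mathbb P_k(d\mathbf x_1)\,\mathbb P_l(d\mathbf x_2)\,\mathbb P(d\mathbf x_3),$$ $$J_{a,b,k,l}:=\int \mathbf 1\{\mathbf x_{2,J}\in A_k\cap A_l\}\,\pi_{a,b}(\mathbf x_1,\mathbf x_2)\,\mathbb P_k(d\mathbf x_1)\,\mathbb P(d\mathbf x_2).$$ With $w^{(k)}_{i,n}:=\mathbf 1\{\mathbf X_{i,J}\in A_k\}/\#\{j\le n:\mathbf X_{j,J}\in A_k\}$ and $s^{(k)}_n:=\sum_{i\le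 n}(w^{(k)}_{i,n})^2$, consider the estimators $$\hat\tau^{(1)}_{a,b,k}:=4\sum_{i,j=1}^n w^{(k)}_{i,n}w^{(k)}_{j,n}\mathbf 1\{X_{i,a}<X_{j,a},X_{i,b}<X_{j,b}\}-1,$$ $$\hat\tau^{(2)}_{a,b,k}:=\sum_{i,j=1}^n w^{(k)}_{i,n}w^{(k)}_{j,n}\big(\mathbf 1\{(X_{i,a}-X_{j,a})(X_{i,b}-X_{j,b})>0\}-\mathbf 1\{(X_{i,a}-X_{j,a})(X_{i,b}-X_{j,b})<0\}\big),$$ $$\hat\tau^{(3)}_{a,b,k}:=1-4\sum_{i,j=1}^n w^{(k)}_{i,n}w^{(k)}_{j,n}\mathbf 1\{X_{i,a}<X_{j,a},X_{i,b}>X_{j,b}\},\qquad \hat\tau_{a,b,k}:=\frac{\hat\tau^{(1)}_{a,b,k}+s^{(k)}_n}{1-s^{(k)}_n}$$ (a quotient with zero denominator is read as $0$; this only occurs with probability tending to $0$). Then, as $n\to\infty$, the stacked random vector $\hat{\mathbf W}:=\big(\sqrt n(\hat\tau_{a,b,k}-\tau_{a,b,k})\big)_{1\le a<b\le p,\;1\le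 k\le m}$, of dimension $mp(p-1)/2$, converges in law to the Gaussian law $\mathcal N(0,\Delta_e)$, and so does each of the vectors $\hat{\mathbf W}^{(j)}$, $j=1,2,3$, obtained by replacing $\hat\tau_{a,b,k}$ with $\hat\tau^{(j)}_{a,b,k}$. Here $\Delta_e$ is the (positive semidefinite) matrix made of the $m\times m$ blocks $$\Delta_{(a,b),(a',b')}:=64\Big[\frac{I_{a,b,a',b',k,l}}{p_kp_l}+\frac{D_{a,b,k}D_{a',b',l}\,p_{k,l}}{p_k^3p_l^3}-\frac{D_{a',b',l}\,J_{a,b,k,l}}{p_kp_l^3}-\frac{D_{a,b,k}\,J_{a',b',l,k}}{p_lp_k^3}\Big]_{1\le k,l\le m},\qquad a<b,\ a'<b'.$$ If moreover the sets $A_1,\dots,A_m$ are pairwise disjoint, then every block is diagonal: $$\Delta_{(a,b),(a',b')}=16\,\mathrm{Diag}\Big(\frac{4I_{a,b,a',b',k,k}}{p_k^2}-\frac{(1+\tau_{a,b,k})(1+\tau_{a',b',k})}{4p_k}\Big)_{1\le k\le m}.$$ -/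

import Mathlib

open MeasureTheory ProbabilityTheory Filter

namespace CondKendall

noncomputable section

/-- Values of the observed vector `X = (X_I, X_J)`: `p` conditioned coordinates `X_I` (first
component) and `q = d - p` conditioning coordinates `X_J` (second component). -/
abbrev Obs (p q : ℕ) : Type := (Fin p → ℝ) × (Fin q → ℝ)

/-- The pairs of indices `(a, b)` with `a < b`. -/
abbrev Pairs (p : ℕ) : Type := {ab : Fin p × Fin p // ab.1 < ab.2}

/-- The indicator `𝟏{s}` of a proposition, as a real number. -/
def ind (s : Prop) : ℝ := open Classical in if s then 1 else 0

variable {p q : ℕ}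

section Population

/-- The event `{X_J ∈ A}`. -/
def condEvent (A : Set (Fin q → ℝ)) : Set (Obs p q) := {x | x.2 ∈ A}

/-- `P(X_J ∈ A)`. Used with `A = A_k` (this is `p_k`) and `A = A_k ∩ A_l` (this is `p_{k,l}`). -/
def prob (P : Measure (Obs p q)) (A : Set (Fin q → ℝ)) : ℝ := P.real (condEvent A)

/-- The law of `X` given `X_J ∈ A`. -/
def condLaw (P : Measure (Obs p q)) (A : Set (Fin q → ℝ)) : Measure (Obs p q) :=
  P[|condEvent A]

/-- The conditional marginal distribution function `t ↦ P(X_a ≤ t | X_J ∈ A)`. -/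
def condMargin (P : Measure (Obs p q)) (A : Set (Fin q → ℝ)) (a : Fin p) (t : ℝ) : ℝ :=
  (condLaw P A).real {x | x.1 a ≤ t}

/-- The Kendall's tau between `X_a` and `X_b` given `X_J ∈ A`: with `X₁, X₂` independent with
law `P`, the probability of concordance minus the probability of discordance, both given
`X_{1,J} ∈ A` and `X_{2,J} ∈ A`. -/
def kendallTau (P : Measure (Obs p q)) (A : Set (Fin q → ℝ)) (a b : Fin p) : ℝ :=
  ((P.prod P)[|{z | z.1.2 ∈ A ∧ z.2.2 ∈ A}]).real
      {z | (z.1.1 a - z.2.1 a) * (z.1.1 b - z.2.1 b) > 0} -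
    ((P.prod P)[|{z | z.1.2 ∈ A ∧ z.2.2 ∈ A}]).real
      {z | (z.1.1 a - z.2.1 a) * (z.1.1 b - z.2.1 b) < 0}

/-- `D_{a,b}(A) = P(X_{1,a} < X_{2,a}, X_{1,b} < X_{2,b}, X_{1,J} ∈ A, X_{2,J} ∈ A)`. -/
def quantD (P : Measure (Obs p q)) (A : Set (Fin q → ℝ)) (a b : Fin p) : ℝ :=
  (P.prod P).real
    {z | z.1.1 a < z.2.1 a ∧ z.1.1 b < z.2.1 b ∧ z.1.2 ∈ A ∧ z.2.2 ∈ A}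

/-- `π_{a,b}(x₁, x₂)`. -/
def concord (a b : Fin p) (x₁ x₂ : Obs p q) : ℝ :=
  (ind (x₁.1 a < x₂.1 a ∧ x₁.1 b < x₂.1 b) + ind (x₂.1 a < x₁.1 a ∧ x₂.1 b < x₁.1 b)) / 2

/-- `I_{a,b,a',b'}(A, B) = ∫ 𝟏{x_{3,J} ∈ A ∩ B} π_{a,b}(x₁, x₃) π_{a',b'}(x₂, x₃)
P(dx₁ | X_J ∈ A) P(dx₂ | X_J ∈ B) P(dx₃)`; the integration variable is `z = (x₁, x₂, x₃)`. -/
def quantI (P : Measure (Obs p q)) (A B : Set (Fin q → ℝ)) (a b a' b' : Fin p) : ℝ :=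
  ∫ z : Obs p q × Obs p q × Obs p q,
    ind (z.2.2.2 ∈ A ∩ B) * concord a b z.1 z.2.2 * concord a' b' z.2.1 z.2.2
    ∂((condLaw P A).prod ((condLaw P B).prod P))

/-- `J_{a,b}(A, B) = ∫ 𝟏{x_{2,J} ∈ A ∩ B} π_{a,b}(x₁, x₂) P(dx₁ | X_J ∈ A) P(dx₂)`;
the integration variable is `z = (x₁, x₂)`. -/
def quantJ (P : Measure (Obs p q)) (A B : Set (Fin q → ℝ)) (a b : Fin p) : ℝ :=
  ∫ z : Obs p q × Obs p q, ind (z.2.2 ∈ A ∩ B) * concord a b z.1 z.2 ∂((condLaw P A).prod P)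

/-- The `m × m` block `Δ_{(a,b),(a',b')}`. -/
def deltaBlock {m : ℕ} (P : Measure (Obs p q)) (A : Fin m → Set (Fin q → ℝ))
    (a b a' b' : Fin p) : Matrix (Fin m) (Fin m) ℝ :=
  Matrix.of fun k l =>
    64 * (quantI P (A k) (A l) a b a' b' / (prob P (A k) * prob P (A l))
      + quantD P (A k) a b * quantD P (A l) a' b' * prob P (A k ∩ A l)
          / (prob P (A k) ^ 3 * prob P (A l) ^ 3)
      - quantD P (A l) a' b' * quantJ P (A k) (A l) a b / (prob P (A k) * prob P (A l) ^ 3)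
      - quantD P (A k) a b * quantJ P (A l) (A k) a' b' / (prob P (A l) * prob P (A k) ^ 3))

/-- The matrix `Δ_e` of size `m p (p - 1) / 2`, made of the blocks `Δ_{(a,b),(a',b')}` over all
pairs `a < b` and `a' < b'`. -/
def deltaE {m : ℕ} (P : Measure (Obs p q)) (A : Fin m → Set (Fin q → ℝ)) :
    Matrix (Pairs p × Fin m) (Pairs p × Fin m) ℝ :=
  Matrix.of fun r s => deltaBlock P A r.1.1.1 r.1.1.2 s.1.1.1 s.1.1.2 r.2 s.2

end Population

section Sample

/-- The size `N_n` of the subsample `{i < n : x_{i,J} ∈ A}` (observations are numbered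
`0, …, n - 1`). -/
def subsampleSize (x : ℕ → Obs p q) (n : ℕ) (A : Set (Fin q → ℝ)) : ℝ :=
  ∑ i ∈ Finset.range n, ind ((x i).2 ∈ A)

/-- The weight `w_{i,n} = 𝟏{x_{i,J} ∈ A} / N_n`. -/
def weight (x : ℕ → Obs p q) (n : ℕ) (A : Set (Fin q → ℝ)) (i : ℕ) : ℝ :=
  ind ((x i).2 ∈ A) / subsampleSize x n A

/-- `s_n = ∑ w_{i,n}²`. -/
def sumSqWeight (x : ℕ → Obs p q) (n : ℕ) (A : Set (Fin q → ℝ)) : ℝ :=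
  ∑ i ∈ Finset.range n, weight x n A i ^ 2

/-- The estimator `τ̂⁽¹⁾`. -/
def tauHat₁ (x : ℕ → Obs p q) (n : ℕ) (A : Set (Fin q → ℝ)) (a b : Fin p) : ℝ :=
  4 * ∑ i ∈ Finset.range n, ∑ j ∈ Finset.range n, weight x n A i * weight x n A j *
    ind ((x i).1 a < (x j).1 a ∧ (x i).1 b < (x j).1 b) - 1

/-- The estimator `τ̂⁽²⁾`. -/
def tauHat₂ (x : ℕ → Obs p q) (n : ℕ) (A : Set (Fin q → ℝ)) (a b : Fin p) : ℝ :=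
  ∑ i ∈ Finset.range n, ∑ j ∈ Finset.range n, weight x n A i * weight x n A j *
    (ind (((x i).1 a - (x j).1 a) * ((x i).1 b - (x j).1 b) > 0) -
      ind (((x i).1 a - (x j).1 a) * ((x i).1 b - (x j).1 b) < 0))

/-- The estimator `τ̂⁽³⁾`. -/
def tauHat₃ (x : ℕ → Obs p q) (n : ℕ) (A : Set (Fin q → ℝ)) (a b : Fin p) : ℝ :=
  1 - 4 * ∑ i ∈ Finset.range n, ∑ j ∈ Finset.range n, weight x n A i * weight x n A j *
    ind ((x i).1 a < (x j).1 a ∧ (x i).1 b > (x j).1 b)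

/-- The rescaled estimator `τ̂ = τ̂⁽¹⁾ / (1 - s_n) + s_n / (1 - s_n)`. -/
def tauHat (x : ℕ → Obs p q) (n : ℕ) (A : Set (Fin q → ℝ)) (a b : Fin p) : ℝ :=
  tauHat₁ x n A a b / (1 - sumSqWeight x n A) + sumSqWeight x n A / (1 - sumSqWeight x n A)

/-- The stacked vector with components `√n (est_{a,b,k} - τ_{a,b | X_J ∈ A_k})`, over all pairs
`a < b` and all `k`, for an estimator `est` computed from the first `n` observations. -/
def stackedW {m : ℕ} (P : Measure (Obs p q)) (A : Fin m → Set (Fin q → ℝ))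
    (est : (ℕ → Obs p q) → ℕ → Set (Fin q → ℝ) → Fin p → Fin p → ℝ)
    (x : ℕ → Obs p q) (n : ℕ) : EuclideanSpace ℝ (Pairs p × Fin m) :=
  WithLp.toLp 2 fun r =>
    √(n : ℝ) * (est x n (A r.2) r.1.1.1 r.1.1.2 - kendallTau P (A r.2) r.1.1.1 r.1.1.2)

end Sample

end

end CondKendall

open CondKendall

/-! Each estimator is, up to a negligible error, a ratio of V-statistics, treated by Hoeffding
projection, the central limit theorem and Slutsky's lemma.

Write `p` for `prob P A`, `D` for `quantD P A a b`, `V = N_n / n`, and `U` for the `n⁻²`-normalised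
sum of the kernel `jointConcord`. Symmetrising in the two indices gives `τ̂⁽¹⁾ = 4 U / V² - 1`.
Continuity of the conditional margins excludes ties, so `τ = 4 D / p² - 1` (`kendallTau_eq`). Hence
`τ̂⁽¹⁾ - τ = 4 (U p² - D V²) / p⁴ · (p² / V²)`, and the last factor tends to `1` almost surely.

The first factor is linearised exactly in `linearizedTau_sub`. The Hoeffding decomposition splits `U
- D` into a sum of projections and a degenerate part, and `V² - p² = 2 p (V - p) + (V - p)²`. The
linear terms add up to the empirical mean of `influence`. The two remainders vanish after
multiplication by `√n`: the degenerate part by a second moment bound (`integral_sq_sum_offDiag_le`),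
the square `(V - p)²` because its mean is of order `1 / n`.

The influence functions are bounded and centred, so the multivariate central limit theorem applies,
and Fubini identifies their covariances with the entries of `deltaE`
(`deltaBlock_apply_eq_integral`). In particular `deltaE` is a Gram matrix, hence positive
semidefinite. For disjoint conditioning sets the influence functions of different blocks have
disjoint supports, so the off-diagonal entries vanish.

The other estimators differ from `τ̂⁽¹⁾` by at most a bounded multiple of `s_n = 1 / N_n` once `N_n`
is large (for `τ̂⁽²⁾` and `τ̂⁽³⁾`, almost surely, since ties must be absent), which is `o(1 / √n)`.
-/

namespace CondKendall

open scoped Topology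

/-! ### Tools for convergence to zero in probability. -/

section ConvergenceInMeasure

variable {Ω : Type*} [MeasurableSpace Ω] {μ : Measure Ω} [IsProbabilityMeasure μ]

/-- Convergence to zero in measure of finitely many real sequences is inherited by a sequence
whose norm is at most the sum of their absolute values. -/
lemma tendstoInMeasure_zero_of_norm_le_sum {κ F : Type*} [Fintype κ] [SeminormedAddCommGroup F]
    {f : κ → ℕ → Ω → ℝ} {g : ℕ → Ω → F}
    (hf : ∀ r, TendstoInMeasure μ (f r) atTop 0) (hg : ∀ n ω, ‖g n ω‖ ≤ ∑ r, |f r n ω|) :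
    TendstoInMeasure μ g atTop 0 := by
  rw [tendstoInMeasure_iff_measureReal_norm]
  intro ε hε
  -- The `+ 1` keeps the quotient meaningful for empty `κ` and makes `card κ * δ < ε` strict.
  set δ : ℝ := ε / (Fintype.card κ + 1) with hδ
  have hδ0 : 0 < δ := by positivity
  have hsum : Tendsto (fun n => ∑ r, μ.real {ω | δ ≤ ‖f r n ω - (0 : Ω → ℝ) ω‖}) atTop (𝓝 0) := by
    rw [show (0 : ℝ) = ∑ _r : κ, (0 : ℝ) by simp]
    exact tendsto_finsetSum _ fun r _ => tendstoInMeasure_iff_measureReal_norm.1 (hf r) δ hδ0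
  refine squeeze_zero (fun n => measureReal_nonneg) (fun n => ?_) hsum
  refine (measureReal_mono (s₂ := ⋃ r, {ω | δ ≤ ‖f r n ω - (0 : Ω → ℝ) ω‖}) ?_
    (measure_ne_top _ _)).trans (measureReal_iUnion_fintype_le _)
  intro ω hω
  simp only [Set.mem_ofPred_eq, Pi.zero_apply, sub_zero] at hω
  simp only [Set.mem_iUnion, Set.mem_ofPred_eq, Pi.zero_apply, sub_zero, Real.norm_eq_abs]
  by_contra! hlt
  have h1 : ∑ r, |f r n ω| ≤ Fintype.card κ * δ := by
    refine (Finset.sum_le_sum fun r _ => (hlt r).le).trans ?_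
    simp
  have h2 : (Fintype.card κ + 1 : ℝ) * δ = ε := by rw [hδ]; field_simp
  linarith [hg n ω]

lemma tendstoInMeasure_zero_const_mul {f : ℕ → Ω → ℝ} (hf : TendstoInMeasure μ f atTop 0)
    (c : ℝ) :
    TendstoInMeasure μ (fun n ω => c * f n ω) atTop 0 := by
  rw [tendstoInMeasure_iff_measureReal_norm] at hf ⊢
  intro ε hε
  refine squeeze_zero (fun n => measureReal_nonneg) (fun n => ?_)
    (hf (ε / (|c| + 1)) (by positivity))
  refine measureReal_mono fun ω hω => ?_
  simp only [Set.mem_ofPred_eq, Pi.zero_apply, sub_zero, Real.norm_eq_abs, abs_mul] at hω ⊢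
  rw [div_le_iff₀ (by positivity)]
  nlinarith [abs_nonneg (f n ω)]

/-- Convergence in mean of nonnegative variables to zero implies convergence in measure. -/
lemma tendstoInMeasure_zero_of_tendsto_integral {f : ℕ → Ω → ℝ} (hf0 : ∀ n ω, 0 ≤ f n ω)
    (hfi : ∀ n, Integrable (f n) μ) (hf : Tendsto (fun n => ∫ ω, f n ω ∂μ) atTop (𝓝 0)) :
    TendstoInMeasure μ f atTop 0 := by
  rw [tendstoInMeasure_iff_measureReal_norm]
  intro ε hε
  have hf' : Tendsto (fun n => ε⁻¹ * ∫ ω, f n ω ∂μ) atTop (𝓝 0) := by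
    simpa using hf.const_mul ε⁻¹
  refine squeeze_zero (fun n => measureReal_nonneg) (fun n => ?_) hf'
  have h := mul_meas_ge_le_integral_of_nonneg (ae_of_all _ (hf0 n)) (hfi n) ε
  have he : {ω | ε ≤ ‖f n ω - (0 : Ω → ℝ) ω‖} = {ω | ε ≤ f n ω} := by
    ext ω; simp [abs_of_nonneg (hf0 n ω)]
  rw [he, le_inv_mul_iff₀ hε]
  exact h

/-- Mean square convergence to zero implies convergence in measure. -/
lemma tendstoInMeasure_zero_of_tendsto_integral_sq {f : ℕ → Ω → ℝ}
    (hfi : ∀ n, Integrable (fun ω => f n ω ^ 2) μ)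
    (hf : Tendsto (fun n => ∫ ω, f n ω ^ 2 ∂μ) atTop (𝓝 0)) :
    TendstoInMeasure μ f atTop 0 := by
  have h := tendstoInMeasure_zero_of_tendsto_integral (fun n ω => sq_nonneg (f n ω)) hfi hf
  rw [tendstoInMeasure_iff_measureReal_norm] at h ⊢
  intro ε hε
  refine (h (ε ^ 2) (by positivity)).congr fun n => ?_
  congr 1
  ext ω
  simp only [Pi.zero_apply, sub_zero, Real.norm_eq_abs, Set.mem_ofPred_eq, abs_pow]
  exact pow_le_pow_iff_left₀ hε.le (abs_nonneg _) (by norm_num)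

end ConvergenceInMeasure

/-! ### Multivariate central limit theorem for bounded functions. -/

section CentralLimit

variable {Ω E ι : Type*} [MeasurableSpace Ω] [MeasurableSpace E] [Fintype ι]
  {μ : Measure Ω} [IsProbabilityMeasure μ] {P : Measure E} {X : ℕ → Ω → E}

lemma integrable_of_abs_le [IsFiniteMeasure P] {f : E → ℝ} (hf : Measurable f) {C : ℝ}
    (hC : ∀ x, |f x| ≤ C) : Integrable f P :=
  Integrable.of_bound hf.aestronglyMeasurable C (ae_of_all _ hC)

/-- Expanding the square gives both positive semidefiniteness of the covariance matrix and the
variance of each one-dimensional projection. -/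
lemma dotProduct_mulVec_eq_integral_sq [IsFiniteMeasure P] {ψ : ι → E → ℝ}
    (hψ : ∀ r, Measurable (ψ r)) {C : ℝ} (hC : ∀ r x, |ψ r x| ≤ C) {S : Matrix ι ι ℝ}
    (hS : ∀ r s, S r s = ∫ x, ψ r x * ψ s x ∂P) (t : ι → ℝ) :
    t ⬝ᵥ S.mulVec t = ∫ x, (∑ r, t r * ψ r x) ^ 2 ∂P := by
  have hi : ∀ r s, Integrable (fun x => ψ r x * ψ s x) P := fun r s =>
    integrable_of_abs_le ((hψ r).mul (hψ s)) (C := C * C) fun x => by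
      rw [abs_mul]
      exact mul_le_mul (hC r x) (hC s x) (abs_nonneg _) ((abs_nonneg _).trans (hC r x))
  have he : ∀ x, (∑ r, t r * ψ r x) ^ 2 = ∑ r, ∑ s, (t r * t s) * (ψ r x * ψ s x) := fun x => by
    rw [sq, Finset.sum_mul_sum]
    exact Finset.sum_congr rfl fun r _ => Finset.sum_congr rfl fun s _ => by ring
  simp_rw [he]
  rw [integral_finsetSum _ fun r _ => integrable_finsetSum _ fun s _ => (hi r s).const_mul _]
  simp only [dotProduct, Matrix.mulVec, Finset.mul_sum]
  refine Finset.sum_congr rfl fun r _ => ?_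
  rw [integral_finsetSum _ fun s _ => (hi r s).const_mul _]
  refine Finset.sum_congr rfl fun s _ => ?_
  rw [integral_const_mul, hS]; ring

lemma posSemidef_of_eq_integral_mul [IsFiniteMeasure P] {ψ : ι → E → ℝ}
    (hψ : ∀ r, Measurable (ψ r)) {C : ℝ} (hC : ∀ r x, |ψ r x| ≤ C) {S : Matrix ι ι ℝ}
    (hS : ∀ r s, S r s = ∫ x, ψ r x * ψ s x ∂P) : S.PosSemidef := by
  refine Matrix.PosSemidef.of_dotProduct_mulVec_nonneg ?_ fun t => ?_
  · ext r s
    simp only [Matrix.conjTranspose_apply, star_trivial, hS]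
    exact integral_congr_ae (ae_of_all _ fun x => mul_comm _ _)
  · rw [star_trivial, dotProduct_mulVec_eq_integral_sq hψ hC hS]
    exact integral_nonneg fun x => sq_nonneg _

/-- The multivariate central limit theorem for bounded centred functions of an i.i.d. sample. -/
theorem tendstoInDistribution_multivariate [DecidableEq ι]
    (hlaw : ∀ i, HasLaw (X i) P μ) (hindep : iIndepFun X μ)
    {ψ : ι → E → ℝ} (hψ : ∀ r, Measurable (ψ r)) {C : ℝ} (hC : ∀ r x, |ψ r x| ≤ C)
    (h0 : ∀ r, ∫ x, ψ r x ∂P = 0) {S : Matrix ι ι ℝ}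
    (hS : ∀ r s, S r s = ∫ x, ψ r x * ψ s x ∂P) :
    TendstoInDistribution
      (fun (n : ℕ) ω => WithLp.toLp 2 fun r => (√(n : ℝ))⁻¹ * ∑ i ∈ Finset.range n, ψ r (X i ω))
      atTop (id : EuclideanSpace ℝ ι → EuclideanSpace ℝ ι) (fun _ => μ)
      (multivariateGaussian 0 S) := by
  have : IsProbabilityMeasure P := (hlaw 0).isProbabilityMeasure_iff.1 inferInstance
  have hpsd := posSemidef_of_eq_integral_mul hψ hC hS
  have hXm := fun i => (hlaw i).aemeasurable
  have hm : ∀ n : ℕ, AEMeasurable (fun ω => (WithLp.toLp 2 fun r =>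
      (√(n : ℝ))⁻¹ * ∑ i ∈ Finset.range n, ψ r (X i ω) : EuclideanSpace ℝ ι)) μ := fun n => by
    refine (WithLp.measurable_toLp 2 _).comp_aemeasurable (aemeasurable_pi_lambda _ fun r => ?_)
    exact (Finset.aemeasurable_fun_sum _ fun i _ => (hψ r).comp_aemeasurable (hXm i)).const_mul _
  refine ⟨hm, by fun_prop, ?_⟩
  refine ProbabilityMeasure.tendsto_iff_tendsto_charFun.2 fun t => ?_
  -- Cramér–Wold: the vector is tested against the fixed direction `t`, which reduces the claim to
  -- the scalar theorem for `f`.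
  set f : E → ℝ := fun x => ∑ r, t r * ψ r x with hf
  have hfm : Measurable f := Finset.measurable_sum _ fun r _ => (hψ r).const_mul _
  have hfC : ∀ x, |f x| ≤ ∑ r, |t r| * C := fun x =>
    (Finset.abs_sum_le_sum_abs _ _).trans (Finset.sum_le_sum fun r _ => by
      rw [abs_mul]; exact mul_le_mul_of_nonneg_left (hC r x) (abs_nonneg _))
  have hf0 : ∫ x, f x ∂P = 0 := by
    rw [hf, integral_finsetSum _ fun r _ => (integrable_of_abs_le (hψ r) (hC r)).const_mul _]
    simp [integral_const_mul, h0]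
  have hmean : ∫ ω, f (X 0 ω) ∂μ = 0 :=
    ((hlaw 0).integral_comp hfm.aestronglyMeasurable).trans hf0
  have hvar : Var[fun ω => f (X 0 ω); μ] = t ⬝ᵥ S.mulVec t := by
    rw [variance_eq_integral (X := fun ω => f (X 0 ω)) (hfm.comp_aemeasurable (hXm 0)), hmean,
      dotProduct_mulVec_eq_integral_sq hψ hC hS]
    simp only [sub_zero]
    exact (hlaw 0).integral_comp (f := fun x => f x ^ 2) (hfm.pow_const 2).aestronglyMeasurable
  have hclt := tendstoInDistribution_inv_sqrt_mul_sum_sub (X := fun i ω => f (X i ω)) (P := μ)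
    (Y := id) (P' := gaussianReal 0 Var[fun ω => f (X 0 ω); μ].toNNReal) HasLaw.id
    (MemLp.of_bound (hfm.comp_aemeasurable (hXm 0)).aestronglyMeasurable _
      (ae_of_all _ fun ω => hfC (X 0 ω)))
    (hindep.comp (fun _ => f) fun _ => hfm)
    (fun i => (IdentDistrib.mk (hXm i) (hXm 0)
      ((hlaw i).map_eq.trans (hlaw 0).map_eq.symm)).comp hfm)
  -- The characteristic function of the vector at `t` is that of its projection along `t` at `1`.
  have hchar := ProbabilityMeasure.tendsto_iff_tendsto_charFun.1 hclt.tendsto 1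
  simp only [ProbabilityMeasure.coe_mk, Measure.map_id, charFun_gaussianReal] at hchar ⊢
  rw [charFun_multivariateGaussian hpsd]
  have hlim : (Complex.exp (↑(inner ℝ t (0 : EuclideanSpace ℝ ι)) * Complex.I
      - ↑(t.ofLp ⬝ᵥ S.mulVec t.ofLp) / 2))
      = Complex.exp (((1 : ℝ) : ℂ) * ((0 : ℝ) : ℂ) * Complex.I
        - ((Var[fun ω => f (X 0 ω); μ].toNNReal : ℝ) : ℂ) * ((1 : ℝ) : ℂ) ^ 2 / 2) := by
    rw [Real.coe_toNNReal _ (variance_nonneg _ _), hvar]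
    simp
  rw [hlim]
  refine hchar.congr fun n => ?_
  rw [charFun_apply, charFun_apply, integral_map (hclt.forall_aemeasurable n) (by fun_prop),
    integral_map (hm n) (by fun_prop)]
  refine integral_congr_ae (ae_of_all _ fun ω => ?_)
  have : (inner ℝ ((√(n : ℝ))⁻¹ * (∑ k ∈ Finset.range n, f (X k ω) - n * ∫ ω, f (X 0 ω) ∂μ))
      (1 : ℝ))
      = inner ℝ (WithLp.toLp 2 fun r => (√(n : ℝ))⁻¹ * ∑ i ∈ Finset.range n, ψ r (X i ω) :
        EuclideanSpace ℝ ι) t := by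
    rw [hmean]
    simp only [mul_zero, sub_zero, hf, PiLp.inner_apply, RCLike.inner_apply, conj_trivial,
      one_mul]
    rw [Finset.sum_comm, Finset.mul_sum]
    refine Finset.sum_congr rfl fun r _ => ?_
    rw [← Finset.mul_sum]; ring
  simp only [this]

end CentralLimit

/-! ### Degenerate kernels and empirical means. -/

section UStatistic

/-- Coincidences among `j`, `k`, `l` are allowed, so every overlap pattern in which `i` occurs only
once is covered. -/
lemma indepFun_triple {Ω E : Type*} [MeasurableSpace Ω] [MeasurableSpace E] {μ : Measure Ω}
    {X : ℕ → Ω → E} (hX : ∀ i, AEMeasurable (X i) μ) (hindep : iIndepFun X μ)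
    {i j k l : ℕ} (hj : i ≠ j) (hk : i ≠ k) (hl : i ≠ l) :
    IndepFun (X i) (fun ω => (X j ω, X k ω, X l ω)) μ := by
  have h := hindep.indepFun_finset₀ {i} {j, k, l} (by simp [hj, hk, hl]) hX
  exact h.comp (φ := fun v : ({i} : Finset ℕ) → E => v ⟨i, by simp⟩)
    (ψ := fun v : ({j, k, l} : Finset ℕ) → E =>
      (v ⟨j, by simp⟩, v ⟨k, by simp⟩, v ⟨l, by simp⟩)) (by fun_prop) (by fun_prop)

variable {Ω E : Type*} [MeasurableSpace Ω] [MeasurableSpace E]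
  {μ : Measure Ω} [IsProbabilityMeasure μ] {P : Measure E} {X : ℕ → Ω → E}

/-- By independence the joint law is a product, and Fubini integrates out `Y` first. -/
lemma integral_comp_eq_zero_of_indepFun {F : Type*} [MeasurableSpace F] {Y : Ω → E} {Z : Ω → F}
    (hY : HasLaw Y P μ) (hZ : AEMeasurable Z μ) (hYZ : IndepFun Y Z μ) {f : E → F → ℝ}
    (hf : Measurable f.uncurry) {C : ℝ} (hC : ∀ y z, |f y z| ≤ C)
    (h0 : ∀ z, ∫ y, f y z ∂P = 0) : ∫ ω, f (Y ω) (Z ω) ∂μ = 0 := by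
  have : IsProbabilityMeasure P := hY.isProbabilityMeasure_iff.1 inferInstance
  have : IsProbabilityMeasure (μ.map Z) := Measure.isProbabilityMeasure_map hZ
  have hmap := (indepFun_iff_map_prod_eq_prod_map_map hY.aemeasurable hZ).1 hYZ
  rw [hY.map_eq] at hmap
  have h := integral_map (hY.aemeasurable.prodMk hZ) (f := f.uncurry) hf.aestronglyMeasurable
  simp only [Function.uncurry_apply_pair] at h
  rw [← h, hmap, integral_prod_symm _ (integrable_of_abs_le hf fun z => hC z.1 z.2)]
  simp [h0]

/-- The second moment of the off-diagonal sum of a bounded degenerate symmetric kernel. -/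
theorem integral_sq_sum_offDiag_le (hlaw : ∀ i, HasLaw (X i) P μ) (hindep : iIndepFun X μ)
    {G : E → E → ℝ} (hG : Measurable G.uncurry) (hsymm : ∀ x y, G x y = G y x) {C : ℝ}
    (hC : ∀ x y, |G x y| ≤ C) (h0 : ∀ y, ∫ x, G x y ∂P = 0) (n : ℕ) :
    ∫ ω, (∑ u ∈ (Finset.range n).offDiag, G (X u.1 ω) (X u.2 ω)) ^ 2 ∂μ
      ≤ 2 * C ^ 2 * (n : ℝ) ^ 2 := by
  have hX := fun i => (hlaw i).aemeasurable
  have hGX : ∀ i j, AEMeasurable (fun ω => G (X i ω) (X j ω)) μ := fun i j =>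
    hG.comp_aemeasurable ((hX i).prodMk (hX j))
  have hbd : ∀ x y z w, |G x y * G z w| ≤ C ^ 2 := fun x y z w => by
    rw [abs_mul, sq]
    exact mul_le_mul (hC x y) (hC z w) (abs_nonneg _) ((abs_nonneg _).trans (hC x y))
  have hi : ∀ i j k l, Integrable (fun ω => G (X i ω) (X j ω) * G (X k ω) (X l ω)) μ :=
    fun i j k l => Integrable.of_bound ((hGX i j).mul (hGX k l)).aestronglyMeasurable (C ^ 2)
      (ae_of_all _ fun ω => hbd _ _ _ _)
  have hle : ∀ i j k l, ∫ ω, G (X i ω) (X j ω) * G (X k ω) (X l ω) ∂μ ≤ C ^ 2 := fun i j k l => by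
    refine (integral_mono (hi i j k l) (integrable_const (C ^ 2)) fun ω =>
      (le_abs_self _).trans (hbd _ _ _ _)).trans ?_
    simp
  have hzero : ∀ i j k l, i ≠ j → i ≠ k → i ≠ l →
      ∫ ω, G (X i ω) (X j ω) * G (X k ω) (X l ω) ∂μ = 0 := fun i j k l hj hk hl => by
    refine integral_comp_eq_zero_of_indepFun (P := P)
      (f := fun x (z : E × E × E) => G x z.1 * G z.2.1 z.2.2) (hlaw i)
      ((hX j).prodMk ((hX k).prodMk (hX l))) (indepFun_triple hX hindep hj hk hl) ?_
      (fun y z => hbd _ _ _ _) fun z => by simp [integral_mul_const, h0]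
    exact (hG.comp (by fun_prop : Measurable fun u : E × E × E × E => (u.1, u.2.1))).mul
      (hG.comp (by fun_prop : Measurable fun u : E × E × E × E => (u.2.2.1, u.2.2.2)))
  set s := (Finset.range n).offDiag with hs
  have hexp : ∀ ω, (∑ u ∈ s, G (X u.1 ω) (X u.2 ω)) ^ 2 =
      ∑ u ∈ s, ∑ v ∈ s, G (X u.1 ω) (X u.2 ω) * G (X v.1 ω) (X v.2 ω) := fun ω => by
    rw [sq, Finset.sum_mul_sum]
  simp_rw [hexp]
  rw [integral_finsetSum _ fun u _ => integrable_finsetSum _ fun v _ => hi _ _ _ _]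
  have hrow : ∀ u ∈ s, ∫ ω, ∑ v ∈ s, G (X u.1 ω) (X u.2 ω) * G (X v.1 ω) (X v.2 ω) ∂μ
      ≤ 2 * C ^ 2 := fun u hu => by
    rw [integral_finsetSum _ fun v _ => hi _ _ _ _]
    -- Degeneracy kills the expectation whenever some index occurs only once among the four. Only `v
    -- = u` and `v = u.swap` survive, so each row contributes at most `2 * C ^ 2`.
    have hu' : u.1 ≠ u.2 := (Finset.mem_offDiag.1 hu).2.2
    calc ∑ v ∈ s, ∫ ω, G (X u.1 ω) (X u.2 ω) * G (X v.1 ω) (X v.2 ω) ∂μ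
        ≤ ∑ v ∈ s, if v ∈ ({u, u.swap} : Finset (ℕ × ℕ)) then C ^ 2 else 0 := by
          refine Finset.sum_le_sum fun v hv => ?_
          have hv' : v.1 ≠ v.2 := (Finset.mem_offDiag.1 hv).2.2
          split_ifs with hmem
          · exact hle _ _ _ _
          · simp only [Finset.mem_insert, Finset.mem_singleton, Prod.ext_iff, Prod.fst_swap,
              Prod.snd_swap, not_or, not_and] at hmem
            -- If `u.1` is shared with `v`, then `u.2` is not, since `v` is neither `u` nor
            -- `u.swap`. Symmetry of `G` then brings `u.2` into the position that is integrated out.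
            by_cases h1 : u.1 = v.1 ∨ u.1 = v.2
            · have h2 : u.2 ≠ v.1 ∧ u.2 ≠ v.2 := by
                rcases h1 with h1 | h1 <;> constructor <;> intro h2 <;> grind
              have := hzero u.2 u.1 v.1 v.2 hu'.symm h2.1 h2.2
              simp_rw [hsymm (X u.1 _)]
              exact this.le
            · exact (hzero u.1 u.2 v.1 v.2 hu' (fun h => h1 (.inl h)) fun h => h1 (.inr h)).le
      _ ≤ ∑ v ∈ ({u, u.swap} : Finset (ℕ × ℕ)), C ^ 2 := by
          rw [← Finset.sum_filter]
          exact Finset.sum_le_sum_of_subset_of_nonneg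
            (fun v hv => (Finset.mem_filter.1 hv).2) fun _ _ _ => sq_nonneg C
      _ ≤ 2 * C ^ 2 := by
          rw [Finset.sum_const, nsmul_eq_mul]
          refine mul_le_mul_of_nonneg_right ?_ (sq_nonneg C)
          exact_mod_cast Finset.card_le_two
  refine (Finset.sum_le_sum hrow).trans ?_
  rw [Finset.sum_const, nsmul_eq_mul, mul_comm]
  refine mul_le_mul_of_nonneg_left ?_ (by positivity)
  have : s.card ≤ n ^ 2 := by
    rw [hs, Finset.offDiag_card, Finset.card_range, sq]; exact Nat.sub_le _ _
  exact_mod_cast this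

/-- A bounded degenerate symmetric kernel contributes nothing at the scale `√n`. -/
theorem tendstoInMeasure_degenerate (hlaw : ∀ i, HasLaw (X i) P μ) (hindep : iIndepFun X μ)
    {G : E → E → ℝ} (hG : Measurable G.uncurry) (hsymm : ∀ x y, G x y = G y x) {C : ℝ}
    (hC : ∀ x y, |G x y| ≤ C) (h0 : ∀ y, ∫ x, G x y ∂P = 0) :
    TendstoInMeasure μ (fun (n : ℕ) ω => √(n : ℝ) * ((∑ i ∈ Finset.range n, ∑ j ∈ Finset.range n,
      G (X i ω) (X j ω)) / (n : ℝ) ^ 2)) atTop 0 := by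
  have hX := fun i => (hlaw i).aemeasurable
  have hGX : ∀ i j, AEMeasurable (fun ω => G (X i ω) (X j ω)) μ := fun i j =>
    hG.comp_aemeasurable ((hX i).prodMk (hX j))
  -- The first component is the off-diagonal sum, of variance `O(1 / n)`. The second bounds the `n`
  -- diagonal terms, where degeneracy says nothing but boundedness suffices.
  let f : Fin 2 → ℕ → Ω → ℝ := ![fun n ω => √(n : ℝ) * (∑ u ∈ (Finset.range n).offDiag,
    G (X u.1 ω) (X u.2 ω)) / (n : ℝ) ^ 2, fun n _ => C * (√(n : ℝ))⁻¹]
  have hsqrt : Tendsto (fun n : ℕ => (√(n : ℝ))⁻¹) atTop (𝓝 0) :=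
    tendsto_inv_atTop_zero.comp (Real.tendsto_sqrt_atTop.comp tendsto_natCast_atTop_atTop)
  refine tendstoInMeasure_zero_of_norm_le_sum (f := f) (fun r => ?_) fun n ω => ?_
  · fin_cases r
    · have hm : ∀ n : ℕ, AEMeasurable (fun ω => ∑ u ∈ (Finset.range n).offDiag,
          G (X u.1 ω) (X u.2 ω)) μ := fun n => Finset.aemeasurable_fun_sum _ fun u _ => hGX _ _
      refine tendstoInMeasure_zero_of_tendsto_integral_sq (fun n => ?_) ?_
      · refine Integrable.of_bound
          ((((hm n).const_mul _).div_const _).pow_const 2).aestronglyMeasurable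
          ((√(n : ℝ) * (∑ _u ∈ (Finset.range n).offDiag, C) / (n : ℝ) ^ 2) ^ 2)
          (ae_of_all _ fun ω => ?_)
        change ‖(√(n : ℝ) * (∑ u ∈ (Finset.range n).offDiag, G (X u.1 ω) (X u.2 ω)) /
          (n : ℝ) ^ 2) ^ 2‖ ≤ _
        simp only [norm_pow, norm_div, norm_mul, Real.norm_eq_abs, Nat.abs_cast,
          abs_of_nonneg (Real.sqrt_nonneg _)]
        gcongr
        exact (Finset.abs_sum_le_sum_abs _ _).trans (Finset.sum_le_sum fun u _ => hC _ _)
      · have hlim : Tendsto (fun n : ℕ => 2 * C ^ 2 * (n : ℝ)⁻¹) atTop (𝓝 0) := by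
          simpa using (tendsto_inv_atTop_zero.comp
            (tendsto_natCast_atTop_atTop (R := ℝ))).const_mul (2 * C ^ 2)
        refine squeeze_zero (fun n => integral_nonneg fun ω => sq_nonneg _) (fun n => ?_) hlim
        rcases Nat.eq_zero_or_pos n with rfl | hn
        · simp [f]
        have hn' : (0 : ℝ) < n := by exact_mod_cast hn
        have he : ∀ ω, (f 0 n ω) ^ 2 = (n : ℝ)⁻¹ ^ 3 * (∑ u ∈ (Finset.range n).offDiag,
            G (X u.1 ω) (X u.2 ω)) ^ 2 := fun ω => by
          simp only [f, Matrix.cons_val_zero, div_pow, mul_pow, Real.sq_sqrt hn'.le]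
          field_simp
        change ∫ ω, (f 0 n ω) ^ 2 ∂μ ≤ _
        simp_rw [he]
        rw [integral_const_mul]
        calc _ ≤ (n : ℝ)⁻¹ ^ 3 * (2 * C ^ 2 * (n : ℝ) ^ 2) :=
              mul_le_mul_of_nonneg_left
                (integral_sq_sum_offDiag_le hlaw hindep hG hsymm hC h0 n) (by positivity)
          _ = 2 * C ^ 2 * (n : ℝ)⁻¹ := by field_simp
    · refine tendstoInMeasure_of_tendsto_ae (fun n => aestronglyMeasurable_const)
        (ae_of_all _ fun ω => ?_)
      simpa [f] using hsqrt.const_mul C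
  · rcases Nat.eq_zero_or_pos n with rfl | hn
    · simp only [Nat.cast_zero, Real.sqrt_zero, zero_mul, norm_zero]; positivity
    have hn' : (0 : ℝ) < n := by exact_mod_cast hn
    have hsplit : ∑ i ∈ Finset.range n, ∑ j ∈ Finset.range n, G (X i ω) (X j ω) =
        ∑ i ∈ Finset.range n, G (X i ω) (X i ω) +
          ∑ u ∈ (Finset.range n).offDiag, G (X u.1 ω) (X u.2 ω) := by
      rw [← Finset.sum_product', ← Finset.diag_union_offDiag,
        Finset.sum_union (Finset.disjoint_diag_offDiag _), Finset.sum_diag]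
    have hC0 : 0 ≤ C := (abs_nonneg _).trans (hC (X 0 ω) (X 0 ω))
    have hdiag : |∑ i ∈ Finset.range n, G (X i ω) (X i ω)| ≤ n * C := by
      refine (Finset.abs_sum_le_sum_abs _ _).trans
        ((Finset.sum_le_sum fun i _ => hC _ _).trans ?_)
      simp
    rw [hsplit, add_div, mul_add, Fin.sum_univ_two, Real.norm_eq_abs, add_comm]
    refine (abs_add_le _ _).trans (add_le_add ?_ ?_)
    · simp only [f, Matrix.cons_val_zero, mul_div_assoc]; exact le_rfl
    · have h1 : √(n : ℝ) * √(n : ℝ) = n := Real.mul_self_sqrt hn'.le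
      have h2 : 0 < √(n : ℝ) := Real.sqrt_pos.2 hn'
      simp only [f, Matrix.cons_val_one, Matrix.cons_val_zero, abs_mul, abs_div, abs_inv,
        abs_of_pos h2, abs_of_nonneg hC0, abs_of_pos (pow_pos hn' 2)]
      calc √(n : ℝ) * (|∑ i ∈ Finset.range n, G (X i ω) (X i ω)| / (n : ℝ) ^ 2)
          ≤ √(n : ℝ) * (n * C / (n : ℝ) ^ 2) := by gcongr
        _ = C * (√(n : ℝ) / n) := by field_simp
        _ = C * (√(n : ℝ))⁻¹ := by
            congr 1; rw [eq_comm, inv_eq_one_div, div_eq_div_iff h2.ne' hn'.ne', h1, one_mul]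

/-- The squared fluctuation of an empirical mean is negligible at the scale `√n`. -/
lemma tendstoInMeasure_sqrt_mul_sq_mean_sub (hlaw : ∀ i, HasLaw (X i) P μ)
    (hindep : iIndepFun X μ) {g : E → ℝ} (hg : Measurable g) {C : ℝ} (hC : ∀ x, |g x| ≤ C) :
    TendstoInMeasure μ (fun (n : ℕ) ω =>
      √(n : ℝ) * ((∑ i ∈ Finset.range n, g (X i ω)) / n - ∫ x, g x ∂P) ^ 2) atTop 0 := by
  have : IsProbabilityMeasure P := (hlaw 0).isProbabilityMeasure_iff.1 inferInstance
  have hX := fun i => (hlaw i).aemeasurable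
  have hgX : ∀ i, MemLp (fun ω => g (X i ω)) 2 μ := fun i =>
    MemLp.of_bound (hg.comp_aemeasurable (hX i)).aestronglyMeasurable _
      (ae_of_all _ fun ω => hC (X i ω))
  have hmean : ∀ i, ∫ ω, g (X i ω) ∂μ = ∫ x, g x ∂P := fun i =>
    (hlaw i).integral_comp hg.aestronglyMeasurable
  have hLp : ∀ n : ℕ, MemLp (fun ω => ∑ i ∈ Finset.range n, g (X i ω)) 2 μ := fun n =>
    memLp_finsetSum _ fun i _ => hgX i
  have hvar : ∀ n : ℕ, Var[fun ω => ∑ i ∈ Finset.range n, g (X i ω); μ] = n * Var[g; P] := by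
    intro n
    have h := IndepFun.variance_sum (μ := μ) (X := fun i ω => g (X i ω)) (s := Finset.range n)
      (fun i _ => hgX i) fun i _ j _ hij =>
        (hindep.comp (fun _ => g) fun _ => hg).indepFun hij
    have h' : (∑ i ∈ Finset.range n, fun ω => g (X i ω)) =
        fun ω => ∑ i ∈ Finset.range n, g (X i ω) := by ext; simp
    rw [h'] at h
    rw [h, Finset.sum_congr rfl fun i _ => (?_ : Var[fun ω => g (X i ω); μ] = Var[g; P])]
    · simp
    · rw [← (hlaw i).map_eq, variance_map hg.aemeasurable (hX i)]
      rfl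
  have hint : ∀ n : ℕ, ∫ ω, ∑ i ∈ Finset.range n, g (X i ω) ∂μ = n * ∫ x, g x ∂P := fun n => by
    rw [integral_finsetSum _ fun i _ => (hgX i).integrable (by norm_num)]
    simp [hmean]
  have hsq : ∀ n : ℕ, Integrable (fun ω =>
      ((∑ i ∈ Finset.range n, g (X i ω)) / n - ∫ x, g x ∂P) ^ 2) μ := fun n => by
    have h : MemLp (fun ω => (∑ i ∈ Finset.range n, g (X i ω)) / n - ∫ x, g x ∂P) 2 μ := by
      simp_rw [div_eq_inv_mul]
      exact ((hLp n).const_mul _).sub (memLp_const _)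
    exact h.integrable_sq
  refine tendstoInMeasure_zero_of_tendsto_integral (fun n ω => by positivity)
    (fun n => (hsq n).const_mul _) ?_
  -- By independence the mean square fluctuation is `Var[g; P] / n`, and the factor `√n` leaves
  -- `Var[g; P] / √n`.
  have hsqrt : Tendsto (fun n : ℕ => Var[g; P] * (√(n : ℝ))⁻¹) atTop (𝓝 0) := by
    simpa using (tendsto_inv_atTop_zero.comp
      (Real.tendsto_sqrt_atTop.comp (tendsto_natCast_atTop_atTop (R := ℝ)))).const_mul Var[g; P]
  refine hsqrt.congr fun n => ?_
  rcases Nat.eq_zero_or_pos n with rfl | hn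
  · simp
  have hn' : (0 : ℝ) < n := by exact_mod_cast hn
  have h2 : 0 < √(n : ℝ) := Real.sqrt_pos.2 hn'
  have he : ∀ ω, ((∑ i ∈ Finset.range n, g (X i ω)) / n - ∫ x, g x ∂P) ^ 2 =
      (n : ℝ)⁻¹ ^ 2 * (∑ i ∈ Finset.range n, g (X i ω) - n * ∫ x, g x ∂P) ^ 2 := fun ω => by
    field_simp
  have hv := variance_eq_integral (hLp n).aestronglyMeasurable.aemeasurable
  rw [hint, hvar] at hv
  simp_rw [he]
  rw [integral_const_mul, integral_const_mul, ← hv]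
  have h1 : √(n : ℝ) ^ 2 = n := Real.sq_sqrt hn'.le
  field_simp
  rw [h1]

/-- The empirical mean of a bounded function converges almost surely. -/
lemma ae_tendsto_mean (hlaw : ∀ i, HasLaw (X i) P μ) (hindep : iIndepFun X μ) {g : E → ℝ}
    (hg : Measurable g) {C : ℝ} (hC : ∀ x, |g x| ≤ C) :
    ∀ᵐ ω ∂μ, Tendsto (fun n : ℕ => (∑ i ∈ Finset.range n, g (X i ω)) / n) atTop
      (𝓝 (∫ x, g x ∂P)) := by
  have hX := fun i => (hlaw i).aemeasurable
  have h := strong_law_ae_real (μ := μ) (fun i ω => g (X i ω))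
    (Integrable.of_bound (hg.comp_aemeasurable (hX 0)).aestronglyMeasurable _
      (ae_of_all _ fun ω => hC (X 0 ω)))
    (fun i j hij => (hindep.comp (fun _ => g) fun _ => hg).indepFun hij)
    (fun i => (IdentDistrib.mk (hX i) (hX 0)
      ((hlaw i).map_eq.trans (hlaw 0).map_eq.symm)).comp hg)
  rwa [show ∫ ω, g (X 0 ω) ∂μ = ∫ x, g x ∂P from
    (hlaw 0).integral_comp hg.aestronglyMeasurable] at h

end UStatistic

/-! ### Real-valued indicators. -/

section Indicator

lemma ind_of_true {s : Prop} (h : s) : ind s = 1 := by simp [ind, h]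

lemma ind_of_false {s : Prop} (h : ¬ s) : ind s = 0 := by simp [ind, h]

lemma ind_nonneg (s : Prop) : 0 ≤ ind s := by
  by_cases h : s <;> simp [ind, h]

lemma ind_le_one (s : Prop) : ind s ≤ 1 := by
  by_cases h : s <;> simp [ind, h]

lemma abs_ind_le_one (s : Prop) : |ind s| ≤ 1 := by
  rw [abs_of_nonneg (ind_nonneg s)]; exact ind_le_one s

lemma ind_and (s t : Prop) : ind (s ∧ t) = ind s * ind t := by
  by_cases h : s <;> by_cases h' : t <;> simp [ind, h, h']

lemma ind_mem_inter {α : Type*} (x : α) (A B : Set α) :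
    ind (x ∈ A ∩ B) = ind (x ∈ A) * ind (x ∈ B) := ind_and _ _

lemma ind_mul_self (s : Prop) : ind s * ind s = ind s := by
  by_cases h : s <;> simp [ind, h]

lemma measurable_ind {α : Type*} [MeasurableSpace α] {s : α → Prop}
    (hs : MeasurableSet {x | s x}) : Measurable fun x => ind (s x) := by
  have : (fun x => ind (s x)) = {x | s x}.indicator fun _ => (1 : ℝ) := by
    ext x; by_cases h : s x <;> simp [ind, h]
  rw [this]; exact measurable_const.indicator hs

lemma integral_ind {α : Type*} [MeasurableSpace α] (ν : Measure α) {s : α → Prop}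
    (hs : MeasurableSet {x | s x}) : ∫ x, ind (s x) ∂ν = ν.real {x | s x} := by
  have : (fun x => ind (s x)) = {x | s x}.indicator fun _ => (1 : ℝ) := by
    ext x; by_cases h : s x <;> simp [ind, h]
  rw [this, integral_indicator_const _ hs, smul_eq_mul, mul_one]

end Indicator

variable {p q : ℕ}

/-! ### The concordance kernel. -/

section Kernel

lemma concord_symm (a b : Fin p) (x y : Obs p q) : concord a b x y = concord a b y x := by
  rw [concord, concord, add_comm]

lemma concord_nonneg (a b : Fin p) (x y : Obs p q) : 0 ≤ concord a b x y :=
  div_nonneg (add_nonneg (ind_nonneg _) (ind_nonneg _)) zero_le_two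

lemma concord_le_one (a b : Fin p) (x y : Obs p q) : concord a b x y ≤ 1 := by
  rw [concord]
  linarith [ind_le_one (x.1 a < y.1 a ∧ x.1 b < y.1 b),
    ind_le_one (y.1 a < x.1 a ∧ y.1 b < x.1 b)]

lemma abs_concord_le_one (a b : Fin p) (x y : Obs p q) : |concord a b x y| ≤ 1 := by
  rw [abs_of_nonneg (concord_nonneg a b x y)]; exact concord_le_one a b x y

lemma measurableSet_concordant (a b : Fin p) :
    MeasurableSet {z : Obs p q × Obs p q | z.1.1 a < z.2.1 a ∧ z.1.1 b < z.2.1 b} := by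
  have h : ∀ c : Fin p, MeasurableSet {z : Obs p q × Obs p q | z.1.1 c < z.2.1 c} := fun c =>
    measurableSet_lt (by fun_prop) (by fun_prop)
  exact (h a).inter (h b)

lemma measurable_concord (a b : Fin p) :
    Measurable fun z : Obs p q × Obs p q => concord a b z.1 z.2 :=
  ((measurable_ind (measurableSet_concordant a b)).add
    ((measurable_ind (measurableSet_concordant a b)).comp measurable_swap)).div_const 2

lemma measurable_ind_cond {A : Set (Fin q → ℝ)} (hA : MeasurableSet A) :
    Measurable fun x : Obs p q => ind (x.2 ∈ A) :=
  measurable_ind (measurable_snd hA)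

lemma measurableSet_condEvent {A : Set (Fin q → ℝ)} (hA : MeasurableSet A) :
    MeasurableSet (condEvent A : Set (Obs p q)) := measurable_snd hA

end Kernel

/-! ### Population quantities, influence functions and their covariances. -/

section Population

variable (P : Measure (Obs p q)) (A B : Set (Fin q → ℝ)) (a b a' b' : Fin p)

/-- The conditional probability of concordance with a given observation, divided by two. -/
noncomputable def condConcord (y : Obs p q) : ℝ := ∫ x, concord a b x y ∂(condLaw P A)

/-- The influence function of the empirical conditional Kendall's tau. -/
noncomputable def influence (y : Obs p q) : ℝ :=
  8 * (ind (y.2 ∈ A) * (condConcord P A a b y / prob P A - quantD P A a b / prob P A ^ 3))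

variable {A B}

lemma integral_condLaw (hA : MeasurableSet A) (f : Obs p q → ℝ) :
    ∫ x, f x ∂(condLaw P A) = (prob P A)⁻¹ * ∫ x, ind (x.2 ∈ A) * f x ∂P := by
  rw [condLaw, ProbabilityTheory.cond, integral_smul_measure, ENNReal.toReal_inv, smul_eq_mul,
    ← integral_indicator (measurableSet_condEvent hA)]
  congr 2
  ext x
  by_cases h : x.2 ∈ A <;> simp [ind, condEvent, h]

instance [IsFiniteMeasure P] : IsFiniteMeasure (condLaw P A) := by
  unfold condLaw; infer_instance

lemma prob_eq_integral (hA : MeasurableSet A) : prob P A = ∫ x, ind (x.2 ∈ A) ∂P :=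
  (integral_ind P (measurableSet_condEvent hA)).symm

lemma measurable_condConcord [IsFiniteMeasure P] : Measurable (condConcord P A a b) :=
  ((measurable_concord a b).stronglyMeasurable.integral_prod_left (μ := condLaw P A)).measurable

lemma isProbabilityMeasure_condLaw [IsFiniteMeasure P] (hpos : 0 < prob P A) :
    IsProbabilityMeasure (condLaw P A) :=
  cond_isProbabilityMeasure fun h => hpos.ne' (by simp [prob, Measure.real, h])

lemma condConcord_nonneg (y : Obs p q) : 0 ≤ condConcord P A a b y :=
  integral_nonneg fun x => concord_nonneg a b x y

lemma condConcord_le_one [IsFiniteMeasure P] (hpos : 0 < prob P A) (y : Obs p q) :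
    condConcord P A a b y ≤ 1 := by
  have := isProbabilityMeasure_condLaw P hpos
  have h := integral_mono (μ := condLaw P A)
    (integrable_of_abs_le ((measurable_concord a b).comp (by fun_prop : Measurable fun x => (x, y)))
      fun x => abs_concord_le_one a b x y) (integrable_const (1 : ℝ))
    fun x => concord_le_one a b x y
  simpa [condConcord] using h

lemma abs_condConcord_le_one [IsFiniteMeasure P] (hpos : 0 < prob P A) (y : Obs p q) :
    |condConcord P A a b y| ≤ 1 := by
  rw [abs_of_nonneg (condConcord_nonneg P a b y)]; exact condConcord_le_one P a b hpos y

lemma integral_ind_mul_concord (hA : MeasurableSet A) (hpos : 0 < prob P A) (y : Obs p q) :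
    ∫ x, ind (x.2 ∈ A) * concord a b x y ∂P = prob P A * condConcord P A a b y := by
  rw [condConcord, integral_condLaw P hA, mul_inv_cancel_left₀ hpos.ne']

/-- Exchanging the two observations preserves the product law, so the indicator of an increasing
pair may be replaced by its symmetrisation `concord`. Integrating one observation out then leaves
`condConcord`. -/
lemma quantD_eq_integral [IsProbabilityMeasure P] (hA : MeasurableSet A) (hpos : 0 < prob P A) :
    quantD P A a b = prob P A * ∫ y, ind (y.2 ∈ A) * condConcord P A a b y ∂P := by
  have hAA : Measurable fun z : Obs p q × Obs p q => ind (z.1.2 ∈ A) * ind (z.2.2 ∈ A) :=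
    ((measurable_ind_cond hA).comp measurable_fst).mul
      ((measurable_ind_cond hA).comp measurable_snd)
  let K : Obs p q × Obs p q → ℝ := fun z =>
    ind (z.1.2 ∈ A) * ind (z.2.2 ∈ A) * ind (z.1.1 a < z.2.1 a ∧ z.1.1 b < z.2.1 b)
  have hK : Measurable K := hAA.mul (measurable_ind (measurableSet_concordant a b))
  have hK1 : ∀ z, |K z| ≤ 1 := fun z => by
    simp only [K, abs_mul]
    exact mul_le_one₀ (mul_le_one₀ (abs_ind_le_one _) (abs_nonneg _) (abs_ind_le_one _))
      (abs_nonneg _) (abs_ind_le_one _)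
  have hKi : Integrable K (P.prod P) := integrable_of_abs_le hK hK1
  have hD : quantD P A a b = ∫ z, K z ∂(P.prod P) := by
    rw [quantD, ← integral_ind]
    · refine integral_congr_ae (ae_of_all _ fun z => ?_)
      simp only [K, ind_and]; ring
    · have h : ∀ c : Fin p, MeasurableSet {z : Obs p q × Obs p q | z.1.1 c < z.2.1 c} := fun c =>
        measurableSet_lt (by fun_prop) (by fun_prop)
      exact (h a).inter ((h b).inter (((measurableSet_condEvent hA).preimage measurable_fst).inter
        ((measurableSet_condEvent hA).preimage measurable_snd)))
  have hswap : ∫ z, K z.swap ∂(P.prod P) = ∫ z, K z ∂(P.prod P) := integral_prod_swap K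
  have hH : ∫ z : Obs p q × Obs p q, ind (z.2.2 ∈ A) * (ind (z.1.2 ∈ A) * concord a b z.1 z.2)
      ∂(P.prod P) = ∫ z, K z ∂(P.prod P) := by
    have : ∀ z : Obs p q × Obs p q, ind (z.2.2 ∈ A) * (ind (z.1.2 ∈ A) * concord a b z.1 z.2)
        = (K z + K z.swap) / 2 := fun z => by
      simp only [K, concord, Prod.fst_swap, Prod.snd_swap]; ring
    simp_rw [this]
    have hKs : Integrable (fun z => K z.swap) (P.prod P) :=
      integrable_of_abs_le (hK.comp measurable_swap) fun z => hK1 _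
    rw [integral_div, integral_add hKi hKs, hswap]
    ring
  rw [hD, ← hH, integral_prod_symm, ← integral_const_mul]
  · refine integral_congr_ae (ae_of_all _ fun y => ?_)
    simp only [integral_const_mul, integral_ind_mul_concord P a b hA hpos]
    ring
  · refine integrable_of_abs_le (C := 1) ?_ fun z => ?_
    · exact ((measurable_ind_cond hA).comp measurable_snd).mul
        (((measurable_ind_cond hA).comp measurable_fst).mul (measurable_concord a b))
    · rw [abs_mul, abs_mul]
      exact mul_le_one₀ (abs_ind_le_one _) (by positivity)
        (mul_le_one₀ (abs_ind_le_one _) (abs_nonneg _) (abs_concord_le_one _ _ _ _))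

lemma quantJ_eq_integral [IsProbabilityMeasure P] (hA : MeasurableSet A) (hB : MeasurableSet B) :
    quantJ P A B a b = ∫ y, ind (y.2 ∈ A) * ind (y.2 ∈ B) * condConcord P A a b y ∂P := by
  rw [quantJ, integral_prod_symm]
  · simp only [integral_const_mul, ind_mem_inter, condConcord]
  · refine integrable_of_abs_le (C := 1) ?_ fun z => ?_
    · exact ((measurable_ind_cond (hA.inter hB)).comp measurable_snd).mul (measurable_concord a b)
    · rw [abs_mul]
      exact mul_le_one₀ (abs_ind_le_one _) (abs_nonneg _) (abs_concord_le_one _ _ _ _)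

/-- With the third observation fixed, the first two are independent and enter separate factors, so
the inner integrals split into a product. -/
lemma quantI_eq_integral [IsProbabilityMeasure P] (hA : MeasurableSet A) (hB : MeasurableSet B)
    (hpos : 0 < prob P A) :
    quantI P A B a b a' b' = ∫ y, ind (y.2 ∈ A) * ind (y.2 ∈ B) *
      (condConcord P A a b y * condConcord P B a' b' y) ∂P := by
  have h1 : Measurable fun z : Obs p q × Obs p q × Obs p q =>
      ind (z.2.2.2 ∈ A ∩ B) * concord a b z.1 z.2.2 * concord a' b' z.2.1 z.2.2 :=
    (((measurable_ind_cond (hA.inter hB)).comp (by fun_prop)).mul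
      ((measurable_concord a b).comp (by fun_prop :
        Measurable fun z : Obs p q × Obs p q × Obs p q => (z.1, z.2.2)))).mul
      ((measurable_concord a' b').comp measurable_snd)
  rw [quantI, integral_prod_symm]
  · have h2 : ∀ z : Obs p q × Obs p q, ∫ x, ind (z.2.2 ∈ A ∩ B) * concord a b x z.2 *
        concord a' b' z.1 z.2 ∂(condLaw P A) =
        ind (z.2.2 ∈ A ∩ B) * condConcord P A a b z.2 * concord a' b' z.1 z.2 := fun z => by
      rw [integral_mul_const, integral_const_mul, condConcord]
    simp only [h2]
    rw [integral_prod_symm]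
    · simp only [integral_const_mul, ind_mem_inter, mul_assoc]
      rfl
    · refine integrable_of_abs_le (C := 1) ?_ fun z => ?_
      · exact (((measurable_ind_cond (hA.inter hB)).comp measurable_snd).mul
          ((measurable_condConcord P a b).comp measurable_snd)).mul (measurable_concord a' b')
      · rw [abs_mul, abs_mul]
        exact mul_le_one₀ (mul_le_one₀ (abs_ind_le_one _) (abs_nonneg _)
          (abs_condConcord_le_one P a b hpos _)) (abs_nonneg _) (abs_concord_le_one _ _ _ _)
  · refine integrable_of_abs_le (C := 1) h1 fun z => ?_
    rw [abs_mul, abs_mul]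
    exact mul_le_one₀ (mul_le_one₀ (abs_ind_le_one _) (abs_nonneg _)
      (abs_concord_le_one _ _ _ _)) (abs_nonneg _) (abs_concord_le_one _ _ _ _)

lemma measurable_influence [IsFiniteMeasure P] (hA : MeasurableSet A) :
    Measurable (influence P A a b) :=
  ((measurable_ind_cond hA).mul
    (((measurable_condConcord P a b).div_const _).sub_const _)).const_mul 8

lemma abs_influence_le [IsFiniteMeasure P] (hpos : 0 < prob P A) (y : Obs p q) :
    |influence P A a b y| ≤ 8 * (1 / prob P A + |quantD P A a b| / prob P A ^ 3) := by
  rw [influence, abs_mul, abs_mul, abs_of_pos (by norm_num : (0 : ℝ) < 8)]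
  refine mul_le_mul_of_nonneg_left ?_ (by norm_num)
  refine (mul_le_of_le_one_left (abs_nonneg _) (abs_ind_le_one _)).trans
    ((abs_sub _ _).trans (add_le_add ?_ ?_))
  · rw [abs_div, abs_of_pos hpos]
    gcongr
    exact abs_condConcord_le_one P a b hpos y
  · rw [abs_div, abs_of_pos (pow_pos hpos 3)]

lemma integrable_ind_mul_condConcord [IsFiniteMeasure P] (hA : MeasurableSet A)
    (hpos : 0 < prob P A) :
    Integrable (fun y => ind (y.2 ∈ A) * condConcord P A a b y) P :=
  integrable_of_abs_le (C := 1) ((measurable_ind_cond hA).mul (measurable_condConcord P a b))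
    fun y => by
      rw [abs_mul]
      exact mul_le_one₀ (abs_ind_le_one _) (abs_nonneg _) (abs_condConcord_le_one P a b hpos y)

lemma integrable_ind_cond [IsFiniteMeasure P] (hA : MeasurableSet A) :
    Integrable (fun y : Obs p q => ind (y.2 ∈ A)) P :=
  integrable_of_abs_le (measurable_ind_cond hA) fun _ => abs_ind_le_one _

/-- The mean of `ind (y.2 ∈ A) * condConcord P A a b y` is `D / p`, so both terms of the influence
function have mean `8 * D / p ^ 2`. -/
lemma integral_influence [IsProbabilityMeasure P] (hA : MeasurableSet A) (hpos : 0 < prob P A) :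
    ∫ y, influence P A a b y ∂P = 0 := by
  have he : ∀ y, influence P A a b y =
      8 / prob P A * (ind (y.2 ∈ A) * condConcord P A a b y) -
        8 * quantD P A a b / prob P A ^ 3 * ind (y.2 ∈ A) := fun y => by
    rw [influence]; ring
  simp_rw [he]
  rw [integral_sub ((integrable_ind_mul_condConcord P a b hA hpos).const_mul _)
    ((integrable_ind_cond P hA).const_mul _), integral_const_mul, integral_const_mul,
    ← prob_eq_integral P hA, quantD_eq_integral P a b hA hpos]
  field_simp
  ring

lemma integral_add_sub_sub {α : Type*} [MeasurableSpace α] {ν : Measure α} {f g h k : α → ℝ}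
    (hf : Integrable f ν) (hg : Integrable g ν) (hh : Integrable h ν) (hk : Integrable k ν) :
    ∫ x, (f x + g x - h x - k x) ∂ν =
      ∫ x, f x ∂ν + ∫ x, g x ∂ν - ∫ x, h x ∂ν - ∫ x, k x ∂ν := by
  have hfg : Integrable (fun x => f x + g x) ν := hf.add hg
  have hfgh : Integrable (fun x => f x + g x - h x) ν := hfg.sub hh
  rw [integral_sub hfgh hk, integral_sub hfg hh, integral_add hf hg]

/-- The entries of the blocks are the covariances of the influence functions. -/
theorem deltaBlock_apply_eq_integral {m : ℕ} [IsProbabilityMeasure P]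
    {A : Fin m → Set (Fin q → ℝ)} (hA : ∀ k, MeasurableSet (A k)) (hpos : ∀ k, 0 < prob P (A k))
    (k l : Fin m) :
    deltaBlock P A a b a' b' k l =
      ∫ y, influence P (A k) a b y * influence P (A l) a' b' y ∂P := by
  set c := prob P (A k)
  set d := prob P (A l)
  set D := quantD P (A k) a b
  set D' := quantD P (A l) a' b'
  have hmkl : Measurable fun y : Obs p q => ind (y.2 ∈ A k) * ind (y.2 ∈ A l) :=
    (measurable_ind_cond (hA k)).mul (measurable_ind_cond (hA l))
  have hckl : ∀ y : Obs p q, |ind (y.2 ∈ A k) * ind (y.2 ∈ A l)| ≤ 1 := fun y => by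
    rw [abs_mul]; exact mul_le_one₀ (abs_ind_le_one _) (abs_nonneg _) (abs_ind_le_one _)
  have hm := measurable_condConcord P (A := A k) a b
  have hm' := measurable_condConcord P (A := A l) a' b'
  have hb := abs_condConcord_le_one P a b (hpos k)
  have hb' := abs_condConcord_le_one P a' b' (hpos l)
  have hiI : Integrable (fun y => ind (y.2 ∈ A k) * ind (y.2 ∈ A l) *
      (condConcord P (A k) a b y * condConcord P (A l) a' b' y)) P :=
    integrable_of_abs_le (C := 1) (hmkl.mul (hm.mul hm')) fun y => by
      rw [abs_mul, abs_mul (condConcord P (A k) a b y)]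
      exact mul_le_one₀ (hckl y) (by positivity) (mul_le_one₀ (hb y) (abs_nonneg _) (hb' y))
  have hiJ : Integrable (fun y => ind (y.2 ∈ A k) * ind (y.2 ∈ A l) *
      condConcord P (A k) a b y) P :=
    integrable_of_abs_le (C := 1) (hmkl.mul hm) fun y => by
      rw [abs_mul]; exact mul_le_one₀ (hckl y) (abs_nonneg _) (hb y)
  have hiJ' : Integrable (fun y => ind (y.2 ∈ A k) * ind (y.2 ∈ A l) *
      condConcord P (A l) a' b' y) P :=
    integrable_of_abs_le (C := 1) (hmkl.mul hm') fun y => by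
      rw [abs_mul]; exact mul_le_one₀ (hckl y) (abs_nonneg _) (hb' y)
  have hi : Integrable (fun y : Obs p q => ind (y.2 ∈ A k) * ind (y.2 ∈ A l)) P :=
    integrable_of_abs_le hmkl hckl
  have he : ∀ y, influence P (A k) a b y * influence P (A l) a' b' y =
      64 / (c * d) * (ind (y.2 ∈ A k) * ind (y.2 ∈ A l) *
        (condConcord P (A k) a b y * condConcord P (A l) a' b' y)) +
      64 * D * D' / (c ^ 3 * d ^ 3) * (ind (y.2 ∈ A k) * ind (y.2 ∈ A l)) -
      64 * D' / (c * d ^ 3) * (ind (y.2 ∈ A k) * ind (y.2 ∈ A l) * condConcord P (A k) a b y) -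
      64 * D / (d * c ^ 3) * (ind (y.2 ∈ A k) * ind (y.2 ∈ A l) * condConcord P (A l) a' b' y) :=
    fun y => by
      have hc : c ≠ 0 := (hpos k).ne'
      have hd : d ≠ 0 := (hpos l).ne'
      simp only [influence]
      change 8 * (_ * (_ / c - D / c ^ 3)) * (8 * (_ * (_ / d - D' / d ^ 3))) = _
      field_simp
      ring
  simp_rw [he]
  rw [integral_add_sub_sub (hiI.const_mul _) (hi.const_mul _) (hiJ.const_mul _) (hiJ'.const_mul _)]
  simp only [integral_const_mul]
  rw [← quantI_eq_integral P a b a' b' (hA k) (hA l) (hpos k),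
    ← quantJ_eq_integral P a b (hA k) (hA l)]
  have hJ' : ∫ y, ind (y.2 ∈ A k) * ind (y.2 ∈ A l) * condConcord P (A l) a' b' y ∂P =
      quantJ P (A l) (A k) a' b' := by
    rw [quantJ_eq_integral P a' b' (hA l) (hA k)]
    simp only [mul_comm (ind (_ ∈ A k))]
  have hkl : ∫ y : Obs p q, ind (y.2 ∈ A k) * ind (y.2 ∈ A l) ∂P = prob P (A k ∩ A l) := by
    rw [prob_eq_integral P ((hA k).inter (hA l))]
    simp only [ind_mem_inter]
  rw [hJ', hkl, deltaBlock, Matrix.of_apply]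
  ring

end Population

/-! ### Absence of ties and the affine formula for Kendall's tau. -/

section Ties

variable (P : Measure (Obs p q)) [IsProbabilityMeasure P] {A : Set (Fin q → ℝ)}

/-- The mass of an atom is the jump of the distribution function, which is zero by continuity. -/
lemma measure_fiber_eq_zero (hA : MeasurableSet A) (hpos : 0 < prob P A) {c : Fin p}
    (hcont : Continuous (condMargin P A c)) (t : ℝ) : P {x | x.2 ∈ A ∧ x.1 c = t} = 0 := by
  have := isProbabilityMeasure_condLaw P hpos
  have hm : Measurable fun x : Obs p q => x.1 c := by fun_prop
  let ν := (condLaw P A).map fun x => x.1 c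
  have : IsProbabilityMeasure ν := Measure.isProbabilityMeasure_map hm.aemeasurable
  have hcdf : (cdf ν : ℝ → ℝ) = condMargin P A c := by
    ext t
    rw [cdf_eq_real, map_measureReal_apply hm measurableSet_Iic]
    rfl
  have hν : ν {t} = 0 := by
    rw [← measure_cdf ν, StieltjesFunction.measure_singleton, hcdf,
      leftLim_eq_of_tendsto hcont.continuousWithinAt, sub_self, ENNReal.ofReal_zero]
  rw [Measure.map_apply hm (measurableSet_singleton t), condLaw,
    cond_apply (measurableSet_condEvent hA)] at hν
  exact (mul_eq_zero.1 hν).resolve_left (ENNReal.inv_ne_zero.2 (measure_ne_top _ _))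

/-- Two independent observations with conditioning coordinates in `A` are almost surely untied. -/
lemma ae_prod_ne (hA : MeasurableSet A) (hpos : 0 < prob P A) {c : Fin p}
    (hcont : Continuous (condMargin P A c)) :
    ∀ᵐ z ∂(P.prod P), z.1.2 ∈ A → z.2.2 ∈ A → z.1.1 c ≠ z.2.1 c := by
  have h1 : MeasurableSet {z : Obs p q × Obs p q | z.1.1 c = z.2.1 c} :=
    measurableSet_eq_fun (by fun_prop) (by fun_prop)
  have hms : MeasurableSet {z : Obs p q × Obs p q |
      z.1.2 ∈ A ∧ z.2.2 ∈ A ∧ z.1.1 c = z.2.1 c} :=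
    ((measurableSet_condEvent hA).preimage measurable_fst).inter
      (((measurableSet_condEvent hA).preimage measurable_snd).inter h1)
  have h0 : (P.prod P) {z | z.1.2 ∈ A ∧ z.2.2 ∈ A ∧ z.1.1 c = z.2.1 c} = 0 := by
    rw [Measure.measure_prod_null hms]
    refine ae_of_all _ fun x => ?_
    refine measure_mono_null (fun y hy => ?_) (measure_fiber_eq_zero P hA hpos hcont (x.1 c))
    exact ⟨hy.2.1, hy.2.2.symm⟩
  rw [ae_iff]
  refine measure_mono_null (fun z hz => ?_) h0
  simp only [Set.mem_ofPred_eq, Classical.not_imp, not_not] at hz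
  exact hz

/-- This also holds with ties, when both sides vanish; only the discordance indicator needs untied
pairs. -/
lemma ind_mul_pos_eq {u v : ℝ} {s t : ℝ} :
    ind ((u - v) * (s - t) > 0) = ind (u < v ∧ s < t) + ind (v < u ∧ t < s) := by
  rcases lt_trichotomy u v with h | h | h
  · have h1 : (u - v) * (s - t) > 0 ↔ s < t := by
      rw [gt_iff_lt, ← neg_mul_neg, neg_sub, neg_sub,
        mul_pos_iff_of_pos_left (sub_pos.2 h), sub_pos]
    simp [ind, h1, h, h.not_gt]
  · simp [ind, h]
  · have h1 : (u - v) * (s - t) > 0 ↔ t < s := by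
      rw [gt_iff_lt, mul_pos_iff_of_pos_left (sub_pos.2 h), sub_pos]
    simp [ind, h1, h, h.not_gt]

lemma ind_mul_neg_eq {u v s t : ℝ} (h : u ≠ v) (h' : s ≠ t) :
    ind ((u - v) * (s - t) < 0) = 1 - ind ((u - v) * (s - t) > 0) := by
  have h0 : (u - v) * (s - t) ≠ 0 := mul_ne_zero (sub_ne_zero.2 h) (sub_ne_zero.2 h')
  rcases h0.lt_or_gt with h1 | h1 <;> simp [ind, h1, h1.not_gt]

lemma measureReal_cond_prod (hA : MeasurableSet A) (T : Set (Obs p q × Obs p q)) :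
    ((P.prod P)[|{z | z.1.2 ∈ A ∧ z.2.2 ∈ A}]).real T =
      (prob P A ^ 2)⁻¹ * (P.prod P).real ({z | z.1.2 ∈ A ∧ z.2.2 ∈ A} ∩ T) := by
  have hS : ({z : Obs p q × Obs p q | z.1.2 ∈ A ∧ z.2.2 ∈ A}) = condEvent A ×ˢ condEvent A := rfl
  rw [hS, measureReal_def,
    cond_apply ((measurableSet_condEvent hA).prod (measurableSet_condEvent hA)),
    Measure.prod_prod, ENNReal.toReal_mul, ENNReal.toReal_inv, ENNReal.toReal_mul, sq]
  rfl

/-- In the absence of ties, Kendall's tau is an affine function of the probability of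
concordance. -/
theorem kendallTau_eq (hA : MeasurableSet A) (hpos : 0 < prob P A) {a b : Fin p}
    (ha : Continuous (condMargin P A a)) (hb : Continuous (condMargin P A b)) :
    kendallTau P A a b = 4 * quantD P A a b / prob P A ^ 2 - 1 := by
  have hS : MeasurableSet {z : Obs p q × Obs p q | z.1.2 ∈ A ∧ z.2.2 ∈ A} :=
    (measurableSet_condEvent hA).prod (measurableSet_condEvent hA)
  have hf : Measurable fun z : Obs p q × Obs p q =>
    (z.1.1 a - z.2.1 a) * (z.1.1 b - z.2.1 b) := by fun_prop
  have hgt : MeasurableSet {z : Obs p q × Obs p q |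
      (z.1.1 a - z.2.1 a) * (z.1.1 b - z.2.1 b) > 0} := measurableSet_lt measurable_const hf
  have hlt : MeasurableSet {z : Obs p q × Obs p q |
      (z.1.1 a - z.2.1 a) * (z.1.1 b - z.2.1 b) < 0} := measurableSet_lt hf measurable_const
  let K : Obs p q × Obs p q → ℝ := fun z =>
    ind (z.1.2 ∈ A ∧ z.2.2 ∈ A) * ind (z.1.1 a < z.2.1 a ∧ z.1.1 b < z.2.1 b)
  have hSm := measurable_ind hS
  have hSi : Integrable (fun z : Obs p q × Obs p q => ind (z.1.2 ∈ A ∧ z.2.2 ∈ A)) (P.prod P) :=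
    integrable_of_abs_le hSm fun _ => abs_ind_le_one _
  have hK : Measurable K := hSm.mul (measurable_ind (measurableSet_concordant a b))
  have hK1 : ∀ z, |K z| ≤ 1 := fun z => by
    simp only [K, abs_mul]
    exact mul_le_one₀ (abs_ind_le_one _) (abs_nonneg _) (abs_ind_le_one _)
  have hKi : Integrable K (P.prod P) := integrable_of_abs_le hK hK1
  have hKs : Integrable (fun z => K z.swap) (P.prod P) :=
    integrable_of_abs_le (hK.comp measurable_swap) fun z => hK1 _
  have hD : quantD P A a b = ∫ z, K z ∂(P.prod P) := by
    have he : {z : Obs p q × Obs p q |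
        z.1.1 a < z.2.1 a ∧ z.1.1 b < z.2.1 b ∧ z.1.2 ∈ A ∧ z.2.2 ∈ A}
        = {z | (z.1.2 ∈ A ∧ z.2.2 ∈ A) ∧ z.1.1 a < z.2.1 a ∧ z.1.1 b < z.2.1 b} := by
      ext z; simp only [Set.mem_ofPred_eq]; tauto
    rw [quantD, he]
    refine (integral_ind (P.prod P) (hS.inter (measurableSet_concordant a b))).symm.trans ?_
    exact integral_congr_ae (ae_of_all _ fun z => ind_mem_inter _ _ _)
  have hswap : ∫ z, K z.swap ∂(P.prod P) = ∫ z, K z ∂(P.prod P) := integral_prod_swap K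
  have hSP : ∫ z : Obs p q × Obs p q, ind (z.1.2 ∈ A ∧ z.2.2 ∈ A) ∂(P.prod P) = prob P A ^ 2 := by
    rw [integral_ind _ hS]
    change (P.prod P).real (condEvent A ×ˢ condEvent A) = _
    rw [measureReal_prod_prod, sq]; rfl
  have hposr : (P.prod P).real ({z | z.1.2 ∈ A ∧ z.2.2 ∈ A} ∩
      {z | (z.1.1 a - z.2.1 a) * (z.1.1 b - z.2.1 b) > 0}) = 2 * quantD P A a b := by
    have h := integral_ind (P.prod P) (hS.inter hgt)
    refine h.symm.trans ?_
    have he : ∀ z : Obs p q × Obs p q, ind (z ∈ {z : Obs p q × Obs p q | z.1.2 ∈ A ∧ z.2.2 ∈ A} ∩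
        {z | (z.1.1 a - z.2.1 a) * (z.1.1 b - z.2.1 b) > 0}) = K z + K z.swap := fun z => by
      rw [ind_mem_inter]
      simp only [Set.mem_ofPred_eq, ind_mul_pos_eq, K, Prod.fst_swap, Prod.snd_swap,
        and_comm (a := z.2.2 ∈ A)]
      ring
    refine (integral_congr_ae (ae_of_all _ he)).trans ?_
    rw [integral_add hKi hKs, hswap, hD]; ring
  have hnegr : (P.prod P).real ({z | z.1.2 ∈ A ∧ z.2.2 ∈ A} ∩
      {z | (z.1.1 a - z.2.1 a) * (z.1.1 b - z.2.1 b) < 0}) =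
      prob P A ^ 2 - 2 * quantD P A a b := by
    have h := integral_ind (P.prod P) (hS.inter hlt)
    refine h.symm.trans ?_
    -- Off the null set of ties, discordance is the complement of concordance within the selected
    -- pairs.
    have he : ∀ᵐ z ∂(P.prod P), ind (z ∈ {z : Obs p q × Obs p q | z.1.2 ∈ A ∧ z.2.2 ∈ A} ∩
        {z | (z.1.1 a - z.2.1 a) * (z.1.1 b - z.2.1 b) < 0}) =
        ind (z.1.2 ∈ A ∧ z.2.2 ∈ A) - (K z + K z.swap) := by
      filter_upwards [ae_prod_ne P hA hpos ha, ae_prod_ne P hA hpos hb] with z hza hzb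
      rw [ind_mem_inter]
      by_cases hz : z.1.2 ∈ A ∧ z.2.2 ∈ A
      · simp only [Set.mem_ofPred_eq, K, Prod.fst_swap, Prod.snd_swap,
          and_comm (a := z.2.2 ∈ A), ind_of_true hz, ind_mul_neg_eq (hza hz.1 hz.2) (hzb hz.1 hz.2),
          ind_mul_pos_eq]
        ring
      · simp [K, ind_of_false hz, and_comm (a := z.2.2 ∈ A)]
    refine (integral_congr_ae he).trans ?_
    have hsum : Integrable (fun z => K z + K z.swap) (P.prod P) := hKi.add hKs
    rw [integral_sub hSi hsum, integral_add hKi hKs, hswap, hSP, hD]; ring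
  rw [kendallTau, measureReal_cond_prod P hA, measureReal_cond_prod P hA, hposr, hnegr]
  have := hpos.ne'
  field_simp
  ring

end Ties

/-! ### Diagonal blocks for disjoint conditioning sets. -/

section Disjoint

/-- For pairwise disjoint conditioning sets every block is diagonal. -/
theorem deltaBlock_eq_diagonal {m : ℕ} (P : Measure (Obs p q)) [IsProbabilityMeasure P]
    {A : Fin m → Set (Fin q → ℝ)} (hA : ∀ k, MeasurableSet (A k)) (hpos : ∀ k, 0 < prob P (A k))
    (hcont : ∀ k a, Continuous (condMargin P (A k) a))
    (hdisj : Pairwise fun k l => Disjoint (A k) (A l)) (a b a' b' : Fin p) :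
    deltaBlock P A a b a' b' = Matrix.diagonal fun k =>
      16 * (4 * quantI P (A k) (A k) a b a' b' / prob P (A k) ^ 2
        - (1 + kendallTau P (A k) a b) * (1 + kendallTau P (A k) a' b') / (4 * prob P (A k))) := by
  ext k l
  rcases eq_or_ne k l with rfl | hkl
  -- On the diagonal the three correction terms are all `D * D' / p ^ 5` up to sign and leave `-D *
  -- D' / p ^ 5`, which becomes the product of the `1 + τ = 4 * D / p ^ 2`.
  · have hJ : ∀ a b : Fin p, quantJ P (A k) (A k) a b = quantD P (A k) a b / prob P (A k) := by
      intro a b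
      rw [quantJ_eq_integral P a b (hA k) (hA k), quantD_eq_integral P a b (hA k) (hpos k),
        mul_div_cancel_left₀ _ (hpos k).ne']
      simp only [ind_mul_self]
    rw [Matrix.diagonal_apply_eq, deltaBlock, Matrix.of_apply, hJ, hJ, Set.inter_self,
      kendallTau_eq P (hA k) (hpos k) (hcont k a) (hcont k b),
      kendallTau_eq P (hA k) (hpos k) (hcont k a') (hcont k b')]
    have := (hpos k).ne'
    field_simp
    ring
  · have h0 : ∀ y : Obs p q, ind (y.2 ∈ A k) * ind (y.2 ∈ A l) = 0 := fun y => by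
      rw [← ind_mem_inter, (hdisj hkl).inter_eq]; exact ind_of_false (Set.notMem_empty _)
    rw [Matrix.diagonal_apply_ne _ hkl, deltaBlock_apply_eq_integral P a b a' b' hA hpos]
    refine (integral_congr_ae (ae_of_all _ fun y => ?_)).trans (integral_zero _ _)
    simp only [influence]
    rw [mul_mul_mul_comm, mul_mul_mul_comm (ind _), h0, zero_mul, mul_zero]

end Disjoint

/-! ### Sample-wise identities between the estimators. -/

section Deterministic

/-- The concordance kernel restricted to pairs of observations with conditioning coordinates
in `A`. -/
noncomputable def jointConcord (A : Set (Fin q → ℝ)) (a b : Fin p) (x y : Obs p q) : ℝ :=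
  ind (x.2 ∈ A) * ind (y.2 ∈ A) * concord a b x y

/-- The sum of the restricted concordance kernel over all pairs of the first `n` observations. -/
noncomputable def concordSum (x : ℕ → Obs p q) (n : ℕ) (A : Set (Fin q → ℝ)) (a b : Fin p) : ℝ :=
  ∑ i ∈ Finset.range n, ∑ j ∈ Finset.range n, jointConcord A a b (x i) (x j)

variable (x : ℕ → Obs p q) (n : ℕ) (A : Set (Fin q → ℝ)) (a b : Fin p)

lemma subsampleSize_nonneg : 0 ≤ subsampleSize x n A := Finset.sum_nonneg fun _ _ => ind_nonneg _

lemma weight_nonneg (i : ℕ) : 0 ≤ weight x n A i :=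
  div_nonneg (ind_nonneg _) (subsampleSize_nonneg x n A)

/-- The weighted proportion of strictly increasing pairs. -/
noncomputable def weightedConcord : ℝ :=
  ∑ i ∈ Finset.range n, ∑ j ∈ Finset.range n, weight x n A i * weight x n A j *
    ind ((x i).1 a < (x j).1 a ∧ (x i).1 b < (x j).1 b)

lemma tauHat₁_eq_weightedConcord : tauHat₁ x n A a b = 4 * weightedConcord x n A a b - 1 := rfl

/-- Averaging the double sum with its transpose symmetrises the kernel. An empty subsample needs no
exception, as both sides are then `0` by division by zero. -/
lemma weightedConcord_eq :
    weightedConcord x n A a b = concordSum x n A a b / subsampleSize x n A ^ 2 := by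
  have hswap : weightedConcord x n A a b =
      ∑ i ∈ Finset.range n, ∑ j ∈ Finset.range n, weight x n A i * weight x n A j *
        ind ((x j).1 a < (x i).1 a ∧ (x j).1 b < (x i).1 b) := by
    rw [weightedConcord, Finset.sum_comm]
    simp only [mul_comm (weight x n A _) (weight x n A _)]
  have h2 : weightedConcord x n A a b + weightedConcord x n A a b =
      2 * (concordSum x n A a b / subsampleSize x n A ^ 2) := by
    nth_rewrite 2 [hswap]
    rw [weightedConcord, concordSum, ← Finset.sum_add_distrib, Finset.sum_div, Finset.mul_sum]
    refine Finset.sum_congr rfl fun i _ => ?_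
    rw [← Finset.sum_add_distrib, Finset.sum_div, Finset.mul_sum]
    refine Finset.sum_congr rfl fun j _ => ?_
    rw [jointConcord, concord, weight, weight]
    ring
  linarith

variable {x n A a b}

lemma sum_weight (hN : subsampleSize x n A ≠ 0) : ∑ i ∈ Finset.range n, weight x n A i = 1 := by
  simp only [weight, ← Finset.sum_div]
  exact div_self hN

lemma sum_sum_weight (hN : subsampleSize x n A ≠ 0) :
    ∑ i ∈ Finset.range n, ∑ j ∈ Finset.range n, weight x n A i * weight x n A j = 1 := by
  rw [← Finset.sum_mul_sum, sum_weight hN, one_mul]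

lemma sumSqWeight_eq (hN : subsampleSize x n A ≠ 0) :
    sumSqWeight x n A = (subsampleSize x n A)⁻¹ := by
  have h : ∀ i, weight x n A i ^ 2 = ind ((x i).2 ∈ A) * (subsampleSize x n A ^ 2)⁻¹ := fun i => by
    rw [weight, div_pow, sq, ind_mul_self, div_eq_mul_inv]
  simp only [sumSqWeight, h, ← Finset.sum_mul]
  change subsampleSize x n A * _ = _
  field_simp

lemma sum_sum_weight_diag : ∑ i ∈ Finset.range n, ∑ j ∈ Finset.range n,
    weight x n A i * weight x n A j * ind (i = j) = sumSqWeight x n A := by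
  refine Finset.sum_congr rfl fun i hi => ?_
  rw [Finset.sum_eq_single i (fun j _ hj => by rw [ind_of_false hj.symm, mul_zero])
    (fun h => absurd hi h), ind_of_true rfl, mul_one, sq]

lemma weightedConcord_nonneg : 0 ≤ weightedConcord x n A a b :=
  Finset.sum_nonneg fun i _ => Finset.sum_nonneg fun j _ =>
    mul_nonneg (mul_nonneg (weight_nonneg x n A i) (weight_nonneg x n A j)) (ind_nonneg _)

lemma weightedConcord_le_one (hN : subsampleSize x n A ≠ 0) : weightedConcord x n A a b ≤ 1 := by
  rw [← sum_sum_weight hN]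
  exact Finset.sum_le_sum fun i _ => Finset.sum_le_sum fun j _ => mul_le_of_le_one_right
    (mul_nonneg (weight_nonneg x n A i) (weight_nonneg x n A j)) (ind_le_one _)

/-- The weights vanish outside `A`, so the absence of ties is only needed among selected
observations. -/
lemma weight_mul_congr {i j : ℕ} {u v : ℝ} (h : (x i).2 ∈ A → (x j).2 ∈ A → u = v) :
    weight x n A i * weight x n A j * u = weight x n A i * weight x n A j * v := by
  by_cases hi : (x i).2 ∈ A
  · by_cases hj : (x j).2 ∈ A
    · rw [h hi hj]
    · simp [weight, ind_of_false hj]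
  · simp [weight, ind_of_false hi]

lemma sum_sum_weight_swap : ∑ i ∈ Finset.range n, ∑ j ∈ Finset.range n,
    weight x n A i * weight x n A j * ind ((x j).1 a < (x i).1 a ∧ (x j).1 b < (x i).1 b) =
    weightedConcord x n A a b := by
  rw [weightedConcord, Finset.sum_comm]
  simp only [mul_comm (weight x n A _) (weight x n A _)]

/-- The absence of ties among the coordinates `c` of the observations selected by `A`. -/
def NoTies (x : ℕ → Obs p q) (A : Set (Fin q → ℝ)) (c : Fin p) : Prop :=
  ∀ i j, i ≠ j → (x i).2 ∈ A → (x j).2 ∈ A → (x i).1 c ≠ (x j).1 c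

/-- For `i ≠ j` the sign kernel is twice the concordance indicator minus `1`. On the diagonal it is
`0` instead of `-1`, which produces the extra `s_n`. -/
lemma tauHat₂_eq (hN : subsampleSize x n A ≠ 0) (ha : NoTies x A a) (hb : NoTies x A b) :
    tauHat₂ x n A a b = tauHat₁ x n A a b + sumSqWeight x n A := by
  have hpt : ∀ i j, weight x n A i * weight x n A j *
      (ind (((x i).1 a - (x j).1 a) * ((x i).1 b - (x j).1 b) > 0) -
        ind (((x i).1 a - (x j).1 a) * ((x i).1 b - (x j).1 b) < 0)) =
      2 * (weight x n A i * weight x n A j *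
        ind ((x i).1 a < (x j).1 a ∧ (x i).1 b < (x j).1 b)) +
      2 * (weight x n A i * weight x n A j *
        ind ((x j).1 a < (x i).1 a ∧ (x j).1 b < (x i).1 b)) -
      weight x n A i * weight x n A j + weight x n A i * weight x n A j * ind (i = j) := by
    intro i j
    rcases eq_or_ne i j with rfl | hij
    · simp [ind]
    · rw [weight_mul_congr
        (v := 2 * ind (((x i).1 a - (x j).1 a) * ((x i).1 b - (x j).1 b) > 0) - 1)
        fun hi hj => by rw [ind_mul_neg_eq (ha i j hij hi hj) (hb i j hij hi hj)]; ring,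
        ind_mul_pos_eq, ind_of_false hij]
      ring
  rw [tauHat₂, tauHat₁_eq_weightedConcord]
  simp only [hpt, Finset.sum_add_distrib, Finset.sum_sub_distrib, ← Finset.mul_sum]
  rw [← Finset.sum_mul, sum_weight hN, one_mul, sum_sum_weight_diag, sum_sum_weight_swap,
    ← weightedConcord]
  ring

/-- An untied pair has exactly one of four orderings, so the increasing and decreasing weights sum
to `1 - s_n`, where `s_n` is the diagonal mass. Transposition pairs the orderings off. -/
lemma tauHat₃_eq (hN : subsampleSize x n A ≠ 0) (ha : NoTies x A a) (hb : NoTies x A b) :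
    tauHat₃ x n A a b = tauHat₁ x n A a b + 2 * sumSqWeight x n A := by
  set T := ∑ i ∈ Finset.range n, ∑ j ∈ Finset.range n, weight x n A i * weight x n A j *
    ind ((x i).1 a < (x j).1 a ∧ (x i).1 b > (x j).1 b) with hT
  have hTs : ∑ i ∈ Finset.range n, ∑ j ∈ Finset.range n, weight x n A i * weight x n A j *
      ind ((x j).1 a < (x i).1 a ∧ (x j).1 b > (x i).1 b) = T := by
    rw [hT, Finset.sum_comm]
    simp only [mul_comm (weight x n A _) (weight x n A _)]
  have hpt : ∀ i j, weight x n A i * weight x n A j *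
      ind ((x i).1 a < (x j).1 a ∧ (x i).1 b > (x j).1 b) +
      weight x n A i * weight x n A j *
      ind ((x j).1 a < (x i).1 a ∧ (x j).1 b > (x i).1 b) =
      weight x n A i * weight x n A j -
      weight x n A i * weight x n A j * ind ((x i).1 a < (x j).1 a ∧ (x i).1 b < (x j).1 b) -
      weight x n A i * weight x n A j * ind ((x j).1 a < (x i).1 a ∧ (x j).1 b < (x i).1 b) -
      weight x n A i * weight x n A j * ind (i = j) := by
    intro i j
    rcases eq_or_ne i j with rfl | hij
    · simp [ind]
    · rw [ind_of_false hij, ← mul_add, weight_mul_congr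
        (v := 1 - ind ((x i).1 a < (x j).1 a ∧ (x i).1 b < (x j).1 b) -
          ind ((x j).1 a < (x i).1 a ∧ (x j).1 b < (x i).1 b)) fun hi hj => ?_]
      · ring
      · rcases (ha i j hij hi hj).lt_or_gt with h1 | h1 <;>
        rcases (hb i j hij hi hj).lt_or_gt with h2 | h2 <;>
        simp [ind, h1, h2, h1.not_gt, h2.not_gt]
  have h2T : T + T = 1 - 2 * weightedConcord x n A a b - sumSqWeight x n A := by
    nth_rewrite 2 [← hTs]
    rw [hT]
    simp only [← Finset.sum_add_distrib, hpt]
    simp only [Finset.sum_sub_distrib]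
    rw [sum_sum_weight hN, sum_sum_weight_diag, sum_sum_weight_swap, ← weightedConcord]
    ring
  rw [tauHat₃, ← hT, tauHat₁_eq_weightedConcord]
  linarith

lemma tauHat_sub_tauHat₁ (hs : sumSqWeight x n A ≠ 1) :
    tauHat x n A a b - tauHat₁ x n A a b =
      4 * weightedConcord x n A a b * sumSqWeight x n A / (1 - sumSqWeight x n A) := by
  have : 1 - sumSqWeight x n A ≠ 0 := sub_ne_zero.2 hs.symm
  rw [tauHat, tauHat₁_eq_weightedConcord]
  field_simp
  ring

section Limit

variable {π : ℝ}

lemma eventually_subsampleSize_ne_zero (hπ : 0 < π)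
    (hV : Tendsto (fun n : ℕ => subsampleSize x n A / n) atTop (𝓝 π)) :
    ∀ᶠ n : ℕ in atTop, 0 < n ∧ subsampleSize x n A ≠ 0 := by
  filter_upwards [hV.eventually_ne hπ.ne', eventually_gt_atTop 0] with n hn hn0
  exact ⟨hn0, fun h => hn (by rw [h, zero_div])⟩

lemma tendsto_inv_sqrt_natCast : Tendsto (fun n : ℕ => (√(n : ℝ))⁻¹) atTop (𝓝 0) :=
  tendsto_inv_atTop_zero.comp (Real.tendsto_sqrt_atTop.comp tendsto_natCast_atTop_atTop)

/-- Since `s_n = 1 / N_n` and `N_n` grows like `π n`, the product is of order `1 / √n`. -/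
lemma tendsto_sqrt_mul_sumSqWeight (hπ : 0 < π)
    (hV : Tendsto (fun n : ℕ => subsampleSize x n A / n) atTop (𝓝 π)) :
    Tendsto (fun n : ℕ => √(n : ℝ) * sumSqWeight x n A) atTop (𝓝 0) := by
  have h := tendsto_inv_sqrt_natCast.mul (hV.inv₀ hπ.ne')
  rw [zero_mul] at h
  refine h.congr' ?_
  filter_upwards [eventually_subsampleSize_ne_zero hπ hV] with n ⟨hn, hN⟩
  have hn' : (0 : ℝ) < n := by exact_mod_cast hn
  have h2 : √(n : ℝ) ≠ 0 := (Real.sqrt_pos.2 hn').ne'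
  have h1 : √(n : ℝ) ^ 2 = n := Real.sq_sqrt hn'.le
  rw [sumSqWeight_eq hN, inv_div]
  field_simp
  exact h1.symm

lemma tendsto_sumSqWeight (hπ : 0 < π)
    (hV : Tendsto (fun n : ℕ => subsampleSize x n A / n) atTop (𝓝 π)) :
    Tendsto (fun n : ℕ => sumSqWeight x n A) atTop (𝓝 0) := by
  have h := tendsto_inv_sqrt_natCast.mul (tendsto_sqrt_mul_sumSqWeight hπ hV)
  rw [zero_mul] at h
  refine h.congr' ?_
  filter_upwards [eventually_gt_atTop 0] with n hn
  have hn' : (0 : ℝ) < n := by exact_mod_cast hn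
  rw [inv_mul_cancel_left₀ (Real.sqrt_pos.2 hn').ne']

lemma tendsto_sqrt_mul_tauHat_sub (hπ : 0 < π)
    (hV : Tendsto (fun n : ℕ => subsampleSize x n A / n) atTop (𝓝 π)) :
    Tendsto (fun n : ℕ => √(n : ℝ) * (tauHat x n A a b - tauHat₁ x n A a b)) atTop (𝓝 0) := by
  have hs := tendsto_sumSqWeight hπ hV
  have h1 : Tendsto (fun n : ℕ => 4 * (√(n : ℝ) * sumSqWeight x n A) / (1 - sumSqWeight x n A))
      atTop (𝓝 0) := by
    have := ((tendsto_sqrt_mul_sumSqWeight hπ hV).const_mul 4).div (hs.const_sub 1) (by norm_num)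
    simp only [mul_zero, sub_zero, zero_div] at this
    exact this
  refine squeeze_zero_norm' ?_ h1
  filter_upwards [eventually_subsampleSize_ne_zero hπ hV,
    hs.eventually_lt_const zero_lt_one] with n ⟨hn, hN⟩ hlt
  have hpos : 0 < 1 - sumSqWeight x n A := sub_pos.2 hlt
  have hs0 : 0 ≤ sumSqWeight x n A := Finset.sum_nonneg fun _ _ => sq_nonneg _
  have hw0 := weightedConcord_nonneg (x := x) (n := n) (A := A) (a := a) (b := b)
  have hw1 := weightedConcord_le_one (a := a) (b := b) hN
  rw [tauHat_sub_tauHat₁ hlt.ne, Real.norm_eq_abs, abs_of_nonneg (by positivity), ← mul_div_assoc]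
  refine div_le_div_of_nonneg_right ?_ hpos.le
  have : 0 ≤ √(n : ℝ) * sumSqWeight x n A := by positivity
  nlinarith

lemma tendsto_sqrt_mul_tauHat₂_sub (hπ : 0 < π)
    (hV : Tendsto (fun n : ℕ => subsampleSize x n A / n) atTop (𝓝 π))
    (ha : NoTies x A a) (hb : NoTies x A b) :
    Tendsto (fun n : ℕ => √(n : ℝ) * (tauHat₂ x n A a b - tauHat₁ x n A a b)) atTop (𝓝 0) := by
  refine (tendsto_sqrt_mul_sumSqWeight hπ hV).congr' ?_
  filter_upwards [eventually_subsampleSize_ne_zero hπ hV] with n ⟨hn, hN⟩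
  rw [tauHat₂_eq hN ha hb, add_sub_cancel_left]

lemma tendsto_sqrt_mul_tauHat₃_sub (hπ : 0 < π)
    (hV : Tendsto (fun n : ℕ => subsampleSize x n A / n) atTop (𝓝 π))
    (ha : NoTies x A a) (hb : NoTies x A b) :
    Tendsto (fun n : ℕ => √(n : ℝ) * (tauHat₃ x n A a b - tauHat₁ x n A a b)) atTop (𝓝 0) := by
  have h := (tendsto_sqrt_mul_sumSqWeight hπ hV).const_mul 2
  rw [mul_zero] at h
  refine h.congr' ?_
  filter_upwards [eventually_subsampleSize_ne_zero hπ hV] with n ⟨hn, hN⟩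
  rw [tauHat₃_eq hN ha hb, add_sub_cancel_left]; ring

end Limit

end Deterministic

/-! ### Measurability of the estimators in the sample. -/

section Measurability

variable (n : ℕ) {A : Set (Fin q → ℝ)} (a b : Fin p)

lemma measurable_subsampleSize (hA : MeasurableSet A) :
    Measurable fun x : ℕ → Obs p q => subsampleSize x n A :=
  Finset.measurable_sum _ fun i _ => (measurable_ind_cond hA).comp (measurable_pi_apply i)

lemma measurable_weight (hA : MeasurableSet A) (i : ℕ) :
    Measurable fun x : ℕ → Obs p q => weight x n A i :=
  ((measurable_ind_cond hA).comp (measurable_pi_apply i)).div (measurable_subsampleSize n hA)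

lemma measurable_sumSqWeight (hA : MeasurableSet A) :
    Measurable fun x : ℕ → Obs p q => sumSqWeight x n A :=
  Finset.measurable_sum _ fun i _ => (measurable_weight n hA i).pow_const 2

lemma measurable_weighted_sum (hA : MeasurableSet A) {f : Obs p q × Obs p q → ℝ}
    (hf : Measurable f) :
    Measurable fun x : ℕ → Obs p q => ∑ i ∈ Finset.range n, ∑ j ∈ Finset.range n,
      weight x n A i * weight x n A j * f (x i, x j) :=
  Finset.measurable_sum _ fun i _ => Finset.measurable_sum _ fun j _ =>
    ((measurable_weight n hA i).mul (measurable_weight n hA j)).mul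
      (hf.comp ((measurable_pi_apply i).prodMk (measurable_pi_apply j)))

lemma measurable_tauHat₁ (hA : MeasurableSet A) :
    Measurable fun x : ℕ → Obs p q => tauHat₁ x n A a b :=
  ((measurable_weighted_sum n hA (measurable_ind (measurableSet_concordant a b))).const_mul
    4).sub_const 1

lemma measurable_tauHat₂ (hA : MeasurableSet A) :
    Measurable fun x : ℕ → Obs p q => tauHat₂ x n A a b := by
  have hf : Measurable fun z : Obs p q × Obs p q =>
    (z.1.1 a - z.2.1 a) * (z.1.1 b - z.2.1 b) := by fun_prop
  exact measurable_weighted_sum n hA ((measurable_ind (measurableSet_lt measurable_const hf)).sub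
    (measurable_ind (measurableSet_lt hf measurable_const)))

lemma measurable_tauHat₃ (hA : MeasurableSet A) :
    Measurable fun x : ℕ → Obs p q => tauHat₃ x n A a b := by
  have h1 : MeasurableSet {z : Obs p q × Obs p q | z.1.1 a < z.2.1 a} :=
    measurableSet_lt (by fun_prop) (by fun_prop)
  have h2 : MeasurableSet {z : Obs p q × Obs p q | z.1.1 b > z.2.1 b} :=
    measurableSet_lt (by fun_prop) (by fun_prop)
  exact ((measurable_weighted_sum n hA (measurable_ind (h1.inter h2))).const_mul 4).const_sub 1

lemma measurable_tauHat (hA : MeasurableSet A) :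
    Measurable fun x : ℕ → Obs p q => tauHat x n A a b :=
  ((measurable_tauHat₁ n a b hA).div ((measurable_sumSqWeight n hA).const_sub 1)).add
    ((measurable_sumSqWeight n hA).div ((measurable_sumSqWeight n hA).const_sub 1))

lemma measurable_jointConcord (hA : MeasurableSet A) :
    Measurable (Function.uncurry (jointConcord A a b)) :=
  (((measurable_ind_cond hA).comp measurable_fst).mul
    ((measurable_ind_cond hA).comp measurable_snd)).mul (measurable_concord a b)

lemma measurable_concordSum (hA : MeasurableSet A) :
    Measurable fun x : ℕ → Obs p q => concordSum x n A a b :=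
  Finset.measurable_sum _ fun i _ => Finset.measurable_sum _ fun j _ =>
    (measurable_jointConcord a b hA).comp (f := fun x : ℕ → Obs p q => (x i, x j))
      ((measurable_pi_apply i).prodMk (measurable_pi_apply j))

end Measurability

/-! ### Hoeffding decomposition of the restricted concordance kernel. -/

section Projection

variable (P : Measure (Obs p q)) (A : Set (Fin q → ℝ)) (a b : Fin p)

/-- The projection of the restricted concordance kernel. -/
noncomputable def kernelProj (y : Obs p q) : ℝ :=
  prob P A * (ind (y.2 ∈ A) * condConcord P A a b y)

/-- The degenerate part of the restricted concordance kernel. -/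
noncomputable def degenerateKernel (x y : Obs p q) : ℝ :=
  jointConcord A a b x y - kernelProj P A a b x - kernelProj P A a b y + quantD P A a b

variable {A}

lemma abs_jointConcord_le_one (x y : Obs p q) : |jointConcord A a b x y| ≤ 1 := by
  rw [jointConcord, abs_mul, abs_mul]
  exact mul_le_one₀ (mul_le_one₀ (abs_ind_le_one _) (abs_nonneg _) (abs_ind_le_one _))
    (abs_nonneg _) (abs_concord_le_one _ _ _ _)

lemma jointConcord_symm (x y : Obs p q) : jointConcord A a b x y = jointConcord A a b y x := by
  rw [jointConcord, jointConcord, concord_symm, mul_comm (ind _)]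

lemma degenerateKernel_symm (x y : Obs p q) :
    degenerateKernel P A a b x y = degenerateKernel P A a b y x := by
  rw [degenerateKernel, degenerateKernel, jointConcord_symm]; ring

variable [IsProbabilityMeasure P]

lemma abs_kernelProj_le_one (hpos : 0 < prob P A) (y : Obs p q) : |kernelProj P A a b y| ≤ 1 := by
  rw [kernelProj, abs_mul, abs_mul, abs_of_pos hpos]
  exact mul_le_one₀ measureReal_le_one (by positivity)
    (mul_le_one₀ (abs_ind_le_one _) (abs_nonneg _) (abs_condConcord_le_one P a b hpos y))

lemma measurable_kernelProj (hA : MeasurableSet A) : Measurable (kernelProj P A a b) :=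
  ((measurable_ind_cond hA).mul (measurable_condConcord P a b)).const_mul _

lemma measurable_degenerateKernel (hA : MeasurableSet A) :
    Measurable (Function.uncurry (degenerateKernel P A a b)) :=
  (((measurable_jointConcord a b hA).sub ((measurable_kernelProj P a b hA).comp measurable_fst)).sub
    ((measurable_kernelProj P a b hA).comp measurable_snd)).add_const _

lemma abs_degenerateKernel_le (hpos : 0 < prob P A) (x y : Obs p q) :
    |degenerateKernel P A a b x y| ≤ 4 := by
  have hD : |quantD P A a b| ≤ 1 := by
    rw [quantD, abs_of_nonneg measureReal_nonneg]; exact measureReal_le_one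
  have h1 := abs_le.1 (abs_jointConcord_le_one (A := A) a b x y)
  have h2 := abs_le.1 (abs_kernelProj_le_one P a b hpos x)
  have h3 := abs_le.1 (abs_kernelProj_le_one P a b hpos y)
  have h4 := abs_le.1 hD
  rw [degenerateKernel, abs_le]
  constructor <;> linarith [h1.1, h1.2, h2.1, h2.2, h3.1, h3.2, h4.1, h4.2]

/-- Integrating out one argument turns the kernel into its projection, and the projection has mean
`D`, so all four terms cancel. -/
lemma integral_degenerateKernel (hA : MeasurableSet A) (hpos : 0 < prob P A) (y : Obs p q) :
    ∫ x, degenerateKernel P A a b x y ∂P = 0 := by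
  have h1 : Integrable (fun x => jointConcord A a b x y) P :=
    integrable_of_abs_le ((measurable_jointConcord a b hA).comp
      (f := fun x => (x, y)) (by fun_prop)) fun x => abs_jointConcord_le_one a b x y
  have h2 : Integrable (kernelProj P A a b) P :=
    integrable_of_abs_le (measurable_kernelProj P a b hA) (abs_kernelProj_le_one P a b hpos)
  have h3 : ∫ x, jointConcord A a b x y ∂P = kernelProj P A a b y := by
    have : ∀ x, jointConcord A a b x y =
        ind (y.2 ∈ A) * (ind (x.2 ∈ A) * concord a b x y) := fun x => by rw [jointConcord]; ring
    simp_rw [this]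
    rw [integral_const_mul, integral_ind_mul_concord P a b hA hpos, kernelProj]; ring
  have h4 : ∫ x, kernelProj P A a b x ∂P = quantD P A a b := by
    rw [quantD_eq_integral P a b hA hpos]; exact integral_const_mul _ _
  have he : ∀ x, degenerateKernel P A a b x y = jointConcord A a b x y + quantD P A a b -
      kernelProj P A a b x - kernelProj P A a b y := fun x => by rw [degenerateKernel]; ring
  simp_rw [he]
  rw [integral_add_sub_sub h1 (integrable_const _) h2 (integrable_const _), h3, h4]
  simp

end Projection

/-! ### Exact linearisation of the numerator. -/

section Linearization

variable (P : Measure (Obs p q)) {A : Set (Fin q → ℝ)} (a b : Fin p)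

/-- The numerator of the centred estimator `τ̂⁽¹⁾`, with the deterministic limit in place of the
random denominator. -/
noncomputable def linearizedTau (A : Set (Fin q → ℝ)) (a b : Fin p)
    (x : ℕ → Obs p q) (n : ℕ) : ℝ :=
  √(n : ℝ) * (4 * (concordSum x n A a b / (n : ℝ) ^ 2 * prob P A ^ 2 -
    quantD P A a b * (subsampleSize x n A / n) ^ 2) / prob P A ^ 4)

/-- An identity, not an approximation: the Hoeffding decomposition of the numerator and the
expansion of `V ^ 2` around `p ^ 2` leave exactly these two remainders, as the constants of both
linear parts cancel. -/
lemma linearizedTau_sub (hpos : 0 < prob P A) (x : ℕ → Obs p q) (n : ℕ) :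
    linearizedTau P A a b x n - (√(n : ℝ))⁻¹ * ∑ i ∈ Finset.range n, influence P A a b (x i) =
      4 / prob P A ^ 2 * (√(n : ℝ) * ((∑ i ∈ Finset.range n, ∑ j ∈ Finset.range n,
        degenerateKernel P A a b (x i) (x j)) / (n : ℝ) ^ 2)) -
      4 * quantD P A a b / prob P A ^ 4 *
        (√(n : ℝ) * ((∑ i ∈ Finset.range n, ind ((x i).2 ∈ A)) / n - prob P A) ^ 2) := by
  rcases Nat.eq_zero_or_pos n with rfl | hn
  · simp [linearizedTau]
  have hn' : (0 : ℝ) < n := by exact_mod_cast hn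
  have h2 : √(n : ℝ) ≠ 0 := (Real.sqrt_pos.2 hn').ne'
  have h1 : √(n : ℝ) ^ 2 = n := Real.sq_sqrt hn'.le
  have hp := hpos.ne'
  set S := ∑ i ∈ Finset.range n, ind ((x i).2 ∈ A) * condConcord P A a b (x i) with hS
  have hG : ∑ i ∈ Finset.range n, ∑ j ∈ Finset.range n, degenerateKernel P A a b (x i) (x j) =
      concordSum x n A a b - 2 * n * (prob P A * S) + n ^ 2 * quantD P A a b := by
    simp only [degenerateKernel, kernelProj, Finset.sum_add_distrib, Finset.sum_sub_distrib,
      Finset.sum_const, Finset.card_range, nsmul_eq_mul, ← Finset.mul_sum, ← hS, concordSum]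
    ring
  have hψ : ∑ i ∈ Finset.range n, influence P A a b (x i) =
      8 * (S / prob P A - quantD P A a b / prob P A ^ 3 * subsampleSize x n A) := by
    have : ∀ i, influence P A a b (x i) =
        8 / prob P A * (ind ((x i).2 ∈ A) * condConcord P A a b (x i)) -
          8 * quantD P A a b / prob P A ^ 3 * ind ((x i).2 ∈ A) := fun i => by
      rw [influence]; ring
    simp only [this, Finset.sum_sub_distrib, ← Finset.mul_sum, ← hS, subsampleSize]
    ring
  have hinv : (√(n : ℝ))⁻¹ = √(n : ℝ) / n := by
    field_simp; exact h1.symm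
  rw [hG, hψ, hinv, linearizedTau, ← subsampleSize]
  field_simp
  ring

end Linearization

/-! ### Almost sure limits and asymptotic normality. -/

section Limit

lemma aemeasurable_sequence {Ω : Type*} [MeasurableSpace Ω] {μ : Measure Ω}
    {P : Measure (Obs p q)} {X : ℕ → Ω → Obs p q} (hlaw : ∀ i, HasLaw (X i) P μ) :
    AEMeasurable (fun ω i => X i ω) μ := aemeasurable_pi_lambda _ fun i => (hlaw i).aemeasurable

variable {Ω : Type*} [MeasurableSpace Ω] {μ : Measure Ω} [IsProbabilityMeasure μ]
  {P : Measure (Obs p q)} {X : ℕ → Ω → Obs p q} {A : Set (Fin q → ℝ)}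

lemma ae_tendsto_subsampleSize (hlaw : ∀ i, HasLaw (X i) P μ) (hindep : iIndepFun X μ)
    (hA : MeasurableSet A) :
    ∀ᵐ ω ∂μ, Tendsto (fun n : ℕ => subsampleSize (fun i => X i ω) n A / n) atTop
      (𝓝 (prob P A)) := by
  rw [prob_eq_integral P hA]
  exact ae_tendsto_mean hlaw hindep (measurable_ind_cond hA) fun _ => abs_ind_le_one _

lemma ae_noTies (hlaw : ∀ i, HasLaw (X i) P μ) (hindep : iIndepFun X μ)
    (hA : MeasurableSet A) (hpos : 0 < prob P A) {c : Fin p}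
    (hcont : Continuous (condMargin P A c)) : ∀ᵐ ω ∂μ, NoTies (fun i => X i ω) A c := by
  have : IsProbabilityMeasure P := (hlaw 0).isProbabilityMeasure_iff.1 inferInstance
  have hX := fun i => (hlaw i).aemeasurable
  refine ae_all_iff.2 fun i => ae_all_iff.2 fun j => ?_
  rcases eq_or_ne i j with rfl | hij
  · exact ae_of_all _ fun ω h => absurd rfl h
  have hmap := (indepFun_iff_map_prod_eq_prod_map_map (hX i) (hX j)).1 (hindep.indepFun hij)
  rw [(hlaw i).map_eq, (hlaw j).map_eq] at hmap
  have h := ae_prod_ne P hA hpos hcont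
  rw [← hmap] at h
  filter_upwards [ae_of_ae_map ((hX i).prodMk (hX j)) h] with ω hω _ using hω

variable {m : ℕ} {B : Fin m → Set (Fin q → ℝ)}

/-- The stacked vector of linearized estimators. -/
noncomputable def linearizedW (P : Measure (Obs p q)) (B : Fin m → Set (Fin q → ℝ))
    (x : ℕ → Obs p q) (n : ℕ) : EuclideanSpace ℝ (Pairs p × Fin m) :=
  WithLp.toLp 2 fun r => linearizedTau P (B r.2) r.1.1.1 r.1.1.2 x n

lemma measurable_linearizedW (hB : ∀ k, MeasurableSet (B k)) (n : ℕ) :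
    Measurable fun x : ℕ → Obs p q => linearizedW P B x n := by
  refine (WithLp.measurable_toLp 2 _).comp (measurable_pi_lambda _ fun r => ?_)
  exact (((((measurable_concordSum n _ _ (hB r.2)).div_const _).mul_const _).sub
    ((((measurable_subsampleSize n (hB r.2)).div_const _).pow_const 2).const_mul _)).const_mul
    4 |>.div_const _).const_mul _

lemma deltaE_apply_eq_integral [IsProbabilityMeasure P] (hB : ∀ k, MeasurableSet (B k))
    (hpos : ∀ k, 0 < prob P (B k)) (r s : Pairs p × Fin m) :
    deltaE P B r s = ∫ y, influence P (B r.2) r.1.1.1 r.1.1.2 y *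
      influence P (B s.2) s.1.1.1 s.1.1.2 y ∂P :=
  deltaBlock_apply_eq_integral P _ _ _ _ hB hpos r.2 s.2

/-- The central limit theorem asks for one bound valid for all components; the sum of the individual
bounds provides it. -/
lemma abs_influence_le_sum [IsProbabilityMeasure P] (hpos : ∀ k, 0 < prob P (B k))
    (r : Pairs p × Fin m) (y : Obs p q) : |influence P (B r.2) r.1.1.1 r.1.1.2 y| ≤
      ∑ s : Pairs p × Fin m, 8 * (1 / prob P (B s.2) +
        |quantD P (B s.2) s.1.1.1 s.1.1.2| / prob P (B s.2) ^ 3) := by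
  refine (abs_influence_le P _ _ (hpos r.2) y).trans ?_
  refine Finset.single_le_sum (f := fun s : Pairs p × Fin m => 8 * (1 / prob P (B s.2) +
    |quantD P (B s.2) s.1.1.1 s.1.1.2| / prob P (B s.2) ^ 3)) (fun s _ => ?_) (Finset.mem_univ r)
  have := hpos s.2
  positivity

theorem posSemidef_deltaE [IsProbabilityMeasure P] (hB : ∀ k, MeasurableSet (B k))
    (hpos : ∀ k, 0 < prob P (B k)) : (deltaE P B : Matrix (Pairs p × Fin m) _ ℝ).PosSemidef :=
  posSemidef_of_eq_integral_mul (fun r => measurable_influence P _ _ (hB r.2))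
    (abs_influence_le_sum hpos) (deltaE_apply_eq_integral hB hpos)

lemma norm_le_sum_abs {ι : Type*} [Fintype ι] (z : EuclideanSpace ℝ ι) : ‖z‖ ≤ ∑ r, |z r| := by
  rw [EuclideanSpace.norm_eq, Real.sqrt_le_left (Finset.sum_nonneg fun _ _ => abs_nonneg _)]
  exact Finset.sum_sq_le_sq_sum_of_nonneg fun _ _ => abs_nonneg _

/-- The empirical mean of the influence functions has the Gaussian limit, and both remainders of
`linearizedTau_sub` vanish in probability. -/
theorem tendstoInDistribution_linearizedW (hlaw : ∀ i, HasLaw (X i) P μ) (hindep : iIndepFun X μ)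
    (hB : ∀ k, MeasurableSet (B k)) (hpos : ∀ k, 0 < prob P (B k)) :
    TendstoInDistribution (fun n ω => linearizedW P B (fun i => X i ω) n) atTop
      (id : EuclideanSpace ℝ (Pairs p × Fin m) → EuclideanSpace ℝ (Pairs p × Fin m))
      (fun _ => μ) (multivariateGaussian 0 (deltaE P B)) := by
  have : IsProbabilityMeasure P := (hlaw 0).isProbabilityMeasure_iff.1 inferInstance
  refine tendstoInDistribution_of_tendstoInMeasure_sub _ _
    (tendstoInDistribution_multivariate hlaw hindep
      (ψ := fun (r : Pairs p × Fin m) => influence P (B r.2) r.1.1.1 r.1.1.2)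
      (fun r => measurable_influence P _ _ (hB r.2)) (abs_influence_le_sum hpos)
      (fun r => integral_influence P _ _ (hB r.2) (hpos r.2)) (deltaE_apply_eq_integral hB hpos))
    ?_ fun n => (measurable_linearizedW hB n).comp_aemeasurable (aemeasurable_sequence hlaw)
  let f : (Pairs p × Fin m) → ℕ → Ω → ℝ := fun r n ω =>
    linearizedTau P (B r.2) r.1.1.1 r.1.1.2 (fun i => X i ω) n -
      (√(n : ℝ))⁻¹ * ∑ i ∈ Finset.range n, influence P (B r.2) r.1.1.1 r.1.1.2 (X i ω)
  refine tendstoInMeasure_zero_of_norm_le_sum (f := f) (fun r => ?_) fun n ω => ?_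
  · have hdeg := tendstoInMeasure_degenerate hlaw hindep
      (measurable_degenerateKernel P r.1.1.1 r.1.1.2 (hB r.2)) (degenerateKernel_symm P _ _)
      (abs_degenerateKernel_le P _ _ (hpos r.2))
      (integral_degenerateKernel P _ _ (hB r.2) (hpos r.2))
    have hmean := tendstoInMeasure_sqrt_mul_sq_mean_sub hlaw hindep (measurable_ind_cond (hB r.2))
      fun _ => abs_ind_le_one _
    rw [← prob_eq_integral P (hB r.2)] at hmean
    let g : Fin 2 → ℕ → Ω → ℝ := ![
      fun n ω => 4 / prob P (B r.2) ^ 2 * (√(n : ℝ) * ((∑ i ∈ Finset.range n,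
        ∑ j ∈ Finset.range n, degenerateKernel P (B r.2) r.1.1.1 r.1.1.2 (X i ω) (X j ω)) /
          (n : ℝ) ^ 2)),
      fun n ω => 4 * quantD P (B r.2) r.1.1.1 r.1.1.2 / prob P (B r.2) ^ 4 * (√(n : ℝ) *
        ((∑ i ∈ Finset.range n, ind ((X i ω).2 ∈ B r.2)) / n - prob P (B r.2)) ^ 2)]
    refine tendstoInMeasure_zero_of_norm_le_sum (f := g) (fun u => ?_) fun n ω => ?_
    · fin_cases u
      · exact tendstoInMeasure_zero_const_mul hdeg _
      · exact tendstoInMeasure_zero_const_mul hmean _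
    · rw [Fin.sum_univ_two, Real.norm_eq_abs]
      simp only [f]
      rw [linearizedTau_sub P _ _ (hpos r.2) (fun i => X i ω) n]
      exact abs_sub _ _
  · exact norm_le_sum_abs _

/-- Pointwise comparison of an estimator with the linearized one. -/
lemma tendsto_stackedW_sub [IsProbabilityMeasure P] (hB : ∀ k, MeasurableSet (B k))
    (hpos : ∀ k, 0 < prob P (B k)) (hcont : ∀ k a, Continuous (condMargin P (B k) a))
    {est : (ℕ → Obs p q) → ℕ → Set (Fin q → ℝ) → Fin p → Fin p → ℝ} {x : ℕ → Obs p q}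
    (hV : ∀ k, Tendsto (fun n : ℕ => subsampleSize x n (B k) / n) atTop (𝓝 (prob P (B k))))
    (hest : ∀ r : Pairs p × Fin m, Tendsto (fun n : ℕ => √(n : ℝ) *
      (est x n (B r.2) r.1.1.1 r.1.1.2 - tauHat₁ x n (B r.2) r.1.1.1 r.1.1.2)) atTop (𝓝 0)) :
    Tendsto (fun n => stackedW P B est x n - WithLp.toLp 2 fun r =>
      linearizedW P B x n r * (prob P (B r.2) ^ 2 / (subsampleSize x n (B r.2) / n) ^ 2))
      atTop (𝓝 0) := by
  have hpi : Tendsto (fun (n : ℕ) (r : Pairs p × Fin m) => stackedW P B est x n r -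
      linearizedW P B x n r * (prob P (B r.2) ^ 2 / (subsampleSize x n (B r.2) / n) ^ 2))
      atTop (𝓝 0) := by
    -- As soon as the subsample is nonempty, `√n (τ̂⁽¹⁾ - τ)` equals the rescaled linearised
    -- component exactly, so only the difference from `τ̂⁽¹⁾` remains.
    refine tendsto_pi_nhds.2 fun r => (hest r).congr' ?_
    filter_upwards [eventually_subsampleSize_ne_zero (hpos r.2) (hV r.2)] with n ⟨hn, hN⟩
    have hn' : (n : ℝ) ≠ 0 := by exact_mod_cast hn.ne'
    have hp := (hpos r.2).ne'
    simp only [stackedW, linearizedW, linearizedTau]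
    rw [kendallTau_eq P (hB r.2) (hpos r.2) (hcont r.2 _) (hcont r.2 _),
      tauHat₁_eq_weightedConcord, weightedConcord_eq]
    field_simp
    ring
  exact ((PiLp.continuous_toLp 2 _).tendsto 0).comp hpi

/-- Any estimator equivalent to `τ̂⁽¹⁾` up to `o(1 / √n)` is asymptotically normal. -/
theorem tendstoInDistribution_stackedW (hlaw : ∀ i, HasLaw (X i) P μ) (hindep : iIndepFun X μ)
    (hB : ∀ k, MeasurableSet (B k)) (hpos : ∀ k, 0 < prob P (B k))
    (hcont : ∀ k a, Continuous (condMargin P (B k) a))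
    {est : (ℕ → Obs p q) → ℕ → Set (Fin q → ℝ) → Fin p → Fin p → ℝ}
    (hmeas : ∀ n (r : Pairs p × Fin m), Measurable fun x => est x n (B r.2) r.1.1.1 r.1.1.2)
    (hest : ∀ᵐ ω ∂μ, ∀ r : Pairs p × Fin m, Tendsto (fun n : ℕ => √(n : ℝ) *
      (est (fun i => X i ω) n (B r.2) r.1.1.1 r.1.1.2 -
        tauHat₁ (fun i => X i ω) n (B r.2) r.1.1.1 r.1.1.2)) atTop (𝓝 0)) :
    TendstoInDistribution (fun n ω => stackedW P B est (fun i => X i ω) n) atTop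
      (id : EuclideanSpace ℝ (Pairs p × Fin m) → EuclideanSpace ℝ (Pairs p × Fin m))
      (fun _ => μ) (multivariateGaussian 0 (deltaE P B)) := by
  have : IsProbabilityMeasure P := (hlaw 0).isProbabilityMeasure_iff.1 inferInstance
  have hXm := aemeasurable_sequence hlaw
  have hV : ∀ᵐ ω ∂μ, ∀ k, Tendsto (fun n : ℕ => subsampleSize (fun i => X i ω) n (B k) / n) atTop
      (𝓝 (prob P (B k))) := ae_all_iff.2 fun k => ae_tendsto_subsampleSize hlaw hindep (hB k)
  let g : EuclideanSpace ℝ (Pairs p × Fin m) × EuclideanSpace ℝ (Pairs p × Fin m) →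
    EuclideanSpace ℝ (Pairs p × Fin m) := fun z => WithLp.toLp 2 fun r => z.1 r * z.2 r
  have hg : Continuous g := by fun_prop
  -- The factor `p² / V²` replaces the deterministic denominator by the random one. It tends to `1`,
  -- so Slutsky's lemma leaves the limit law unchanged.
  let Y : ℕ → (ℕ → Obs p q) → EuclideanSpace ℝ (Pairs p × Fin m) := fun n x =>
    WithLp.toLp 2 fun r => prob P (B r.2) ^ 2 / (subsampleSize x n (B r.2) / n) ^ 2
  have hY : ∀ n, Measurable (Y n) := fun n =>
    (WithLp.measurable_toLp 2 _).comp (measurable_pi_lambda _ fun r => measurable_const.div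
      (((measurable_subsampleSize n (hB r.2)).div_const _).pow_const 2))
  have hYm : ∀ n, AEMeasurable (fun ω => Y n fun i => X i ω) μ := fun n =>
    (hY n).comp_aemeasurable hXm
  have hYlim : TendstoInMeasure μ (fun n ω => Y n fun i => X i ω) atTop
      fun _ => WithLp.toLp 2 fun _ => 1 := by
    refine tendstoInMeasure_of_tendsto_ae (fun n => (hYm n).aestronglyMeasurable) ?_
    filter_upwards [hV] with ω hω
    refine ((PiLp.continuous_toLp 2 _).tendsto _).comp (tendsto_pi_nhds.2 fun r => ?_)
    have h0 := (pow_pos (hpos r.2) 2).ne'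
    have h := (tendsto_const_nhds (x := prob P (B r.2) ^ 2)).div ((hω r.2).pow 2) h0
    rw [div_self h0] at h
    exact h
  have hslutsky := (tendstoInDistribution_linearizedW hlaw hindep hB
    hpos).continuous_comp_prodMk_of_tendstoInMeasure_const hg hYlim hYm
  have hid : (fun ω => g (id ω, WithLp.toLp 2 fun _ => 1)) = id := by
    ext z r; simp [g]
  rw [hid] at hslutsky
  have hW : ∀ n, AEMeasurable (fun ω => stackedW P B est (fun i => X i ω) n) μ := fun n => by
    refine Measurable.comp_aemeasurable (g := fun x => stackedW P B est x n) ?_ hXm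
    exact (WithLp.measurable_toLp 2 _).comp (measurable_pi_lambda _ fun r =>
      ((hmeas n r).sub_const _).const_mul _)
  refine tendstoInDistribution_of_tendstoInMeasure_sub _ _ hslutsky ?_ hW
  refine tendstoInMeasure_of_tendsto_ae
    (fun n => ((hW n).sub (hslutsky.forall_aemeasurable n)).aestronglyMeasurable) ?_
  filter_upwards [hV, hest] with ω hω hω'
  exact tendsto_stackedW_sub hB hpos hcont hω hω'

end Limit

/-- Counting by the larger index `b`, there are `b` choices for the smaller one. -/
lemma card_pairs (p : ℕ) : Fintype.card (Pairs p) = p * (p - 1) / 2 := by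
  rw [Fintype.card_subtype, Finset.card_filter, Fintype.sum_prod_type_right, ← Finset.sum_range_id,
    ← Fin.sum_univ_eq_sum_range]
  refine Finset.sum_congr rfl fun b _ => ?_
  rw [← Finset.card_filter, ← Fin.card_Iio b]
  congr 1
  ext a; simp

end CondKendall

/-! ### The main theorem. -/

theorem mainTheorem5 {Ω : Type*} [MeasurableSpace Ω] (μ : Measure Ω) [IsProbabilityMeasure μ]
    {p q m : ℕ} (P : Measure (Obs p q)) (X : ℕ → Ω → Obs p q)
    (hlaw : ∀ i, HasLaw (X i) P μ) (hindep : iIndepFun X μ)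
    (A : Fin m → Set (Fin q → ℝ)) (hA : ∀ k, MeasurableSet (A k))
    (hpos : ∀ k, 0 < prob P (A k))
    (hcont : ∀ k a, Continuous (condMargin P (A k) a)) :
    Fintype.card (Pairs p × Fin m) = m * (p * (p - 1) / 2) ∧
    (deltaE P A).PosSemidef ∧
    (∀ est ∈ ({tauHat, tauHat₁, tauHat₂, tauHat₃} :
        Set ((ℕ → Obs p q) → ℕ → Set (Fin q → ℝ) → Fin p → Fin p → ℝ)),
      TendstoInDistribution (fun n ω => stackedW P A est (fun i => X i ω) n) atTop
        (id : EuclideanSpace ℝ (Pairs p × Fin m) → EuclideanSpace ℝ (Pairs p × Fin m))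
        (fun _ => μ) (multivariateGaussian 0 (deltaE P A))) ∧
    (Pairwise (fun k l => Disjoint (A k) (A l)) →
      ∀ ab ab' : Pairs p,
        deltaBlock P A ab.1.1 ab.1.2 ab'.1.1 ab'.1.2 = Matrix.diagonal fun k =>
          16 * (4 * quantI P (A k) (A k) ab.1.1 ab.1.2 ab'.1.1 ab'.1.2 / prob P (A k) ^ 2
            - (1 + kendallTau P (A k) ab.1.1 ab.1.2) * (1 + kendallTau P (A k) ab'.1.1 ab'.1.2)
                / (4 * prob P (A k)))) := by
  have : IsProbabilityMeasure P := (hlaw 0).isProbabilityMeasure_iff.1 inferInstance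
  refine ⟨?_, posSemidef_deltaE hA hpos, ?_, fun hdisj ab ab' =>
    deltaBlock_eq_diagonal P hA hpos hcont hdisj _ _ _ _⟩
  · rw [Fintype.card_prod, card_pairs, Fintype.card_fin, mul_comm]
  have hV : ∀ᵐ ω ∂μ, ∀ k, Tendsto (fun n : ℕ => subsampleSize (fun i => X i ω) n (A k) / n) atTop
      (nhds (prob P (A k))) := ae_all_iff.2 fun k => ae_tendsto_subsampleSize hlaw hindep (hA k)
  have hT : ∀ᵐ ω ∂μ, ∀ k a, NoTies (fun i => X i ω) (A k) a := ae_all_iff.2 fun k =>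
    ae_all_iff.2 fun a => ae_noTies hlaw hindep (hA k) (hpos k) (hcont k a)
  have key := fun est => tendstoInDistribution_stackedW (est := est) hlaw hindep hA hpos hcont
  rintro est (rfl | rfl | rfl | rfl)
  · refine key _ (fun n r => measurable_tauHat n _ _ (hA r.2)) ?_
    filter_upwards [hV] with ω hω r using tendsto_sqrt_mul_tauHat_sub (hpos r.2) (hω r.2)
  · refine key _ (fun n r => measurable_tauHat₁ n _ _ (hA r.2)) (ae_of_all _ fun ω r => ?_)
    simp only [sub_self, mul_zero]
    exact tendsto_const_nhds
  · refine key _ (fun n r => measurable_tauHat₂ n _ _ (hA r.2)) ?_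
    filter_upwards [hV, hT] with ω hω hω' r using
      tendsto_sqrt_mul_tauHat₂_sub (hpos r.2) (hω r.2) (hω' r.2 _) (hω' r.2 _)
  · refine key _ (fun n r => measurable_tauHat₃ n _ _ (hA r.2)) ?_
    filter_upwards [hV, hT] with ω hω hω' r using
      tendsto_sqrt_mul_tauHat₃_sub (hpos r.2) (hω r.2) (hω' r.2 _) (hω' r.2 _)
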